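/- Let $n\ge 3$. On $(\mathbb C^2)^{\otimes n}$ consider $H_0=\sum_{j=1}^{n-1}\sigma_z^j\sigma_z^{j+1}+\sigma_z^n\sigma_z^1$ and $H_1=\sum_{j=1}^n\sigma_x^j$, where $\sigma^j$ denotes $\sigma$ acting on the $j$-th tensor factor, $\sigma_x=\begin{pmatrix}0&1\\1&0\end{pmatrix}$, $\sigma_y=\begin{pmatrix}0&i\\-i&0\end{pmatrix}$, $\sigma_z=\begin{pmatrix}1&0\\0&-1\end{pmatrix}$. Let $\mathcal L$ be the real Lie algebra generated by $iH_0$ and $iH_1$ under the matrix commutator. For a matrix $A$ on $(\mathbb C^2)^{\otimes n}$ let $\mathcal C(A)=\sum_{P\in C_n}PAP^T$, where $C_n$ is the cyclic group of order $n$ permuting the tensor factors cyclically. For $j=0,\dots,n-2$ put $$\mathbf Y^j=i\,\mathcal C(\sigma_y\otimes\sigma_x^{\otimes j}\otimes\sigma_y\otimes\mathbf 1^{\otimes n-j-2}),\qquad \mathbf Z^j=i\,\mathcal C(\sigma_z\otimes\sigma_x^{\otimes j}\otimes\sigma_z\otimes\mathbf 1^{\otimes n-j-2}),$$ $$\mathbf{YZ}^j=i\,\mathcal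 C(\sigma_z\otimes\sigma_x^{\otimes j}\otimes\sigma_y\otimes\mathbf 1^{\otimes n-j-2})+i\,\mathcal C(\sigma_y\otimes\sigma_x^{\otimes j}\otimes\sigma_z\otimes\mathbf 1^{\otimes n-j-2}),$$ and $\mathbf X=i\,\mathcal C(\sigma_x\otimes\mathbf 1^{\otimes n-1})$, $\mathbf{XX}=i\,\mathcal C(\sigma_x^{\otimes n-1}\otimes\mathbf 1)$. Define polynomials by $a_{-1}=0$, $a_0=1$, $a_k=\lambda a_{k-1}-a_{k-2}$ for $k\ge 1$. Let $\bar\lambda\in\mathbb R$ be a root of $a_{n-1}$, write $a_k=a_k(\bar\lambda)$, and put $$\hat X=a_0(\mathbf X+\mathbf Z^1)+a_{n-2}(\mathbf{XX}-\mathbf Y^{n-3})+\sum_{k=1}^{n-3}a_k(\mathbf Z^{k+1}-\mathbf Y^{k-1}),$$ $$\hat Y=\sum_{k=0}^{n-2}a_k(\mathbf Y^k-\mathbf Z^k),\qquad \hat Z=\sum_{k=0}^{n-2}a_k\mathbf{YZ}^k,\qquad \mathcal I_{\bar\lambda}=\operatorname{span}_{\mathbb R}\{\hat X,\hat Y,\hat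 Z\}.$$ Let $\|A\|=\sqrt{\tfrac{1}{n2^n}\operatorname{Tr}(AA^\dagger)}$, $\tilde S_x=\hat X+\hat Y$, $\tilde S_y=\hat X-\hat Y$, and $$S_x=-\frac{1}{2\sqrt{2-\bar\lambda}\,\|\tilde S_x\|\,\|\tilde S_y\|}\tilde S_x,\qquad S_y=\frac{1}{2\sqrt{2-\bar\lambda}\,\|\tilde S_y\|^2}\tilde S_y,\qquad S_z=\frac{1}{2\|\tilde S_x\|\,\|\tilde S_y\|}\hat Z.$$ Then $S_x,S_y,S_z$ form a basis of the real vector space $\mathcal I_{\bar\lambda}$ and $$[S_x,S_y]=S_z,\qquad [S_y,S_z]=S_x,\qquad [S_z,S_x]=S_y.$$ Moreover $\mathcal I_{\bar\lambda}$ is contained in $\mathcal L$, is an ideal of $\mathcal L$, and as a real Lie algebra is isomorphic to $su(2)$, the Lie algebra of traceless skew-Hermitian $2\times2$ complex matrices. -/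

import Mathlib

-- Matrices carry the commutator bracket `⁅A, B⁆ = A * B - B * A`.
attribute [local instance 100] LieRing.ofAssociativeRing

namespace IsingChain

open Matrix Polynomial

/-- The Pauli matrix `σ_x`. -/
def sigmaX : Matrix (Fin 2) (Fin 2) ℂ := !![0, 1; 1, 0]

/-- The Pauli matrix `σ_y`, with the sign convention `[iσ_x, iσ_y] = 2iσ_z`. -/
noncomputable def sigmaY : Matrix (Fin 2) (Fin 2) ℂ := !![0, Complex.I; -Complex.I, 0]

/-- The Pauli matrix `σ_z`. -/
def sigmaZ : Matrix (Fin 2) (Fin 2) ℂ := !![1, 0; 0, -1]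

/-- Matrices acting on the `2 ^ n`-dimensional space `(ℂ²)^{⊗ n}`, whose standard basis vectors
`e_{p 0} ⊗ ⋯ ⊗ e_{p (n-1)}` are indexed by the functions `p : Fin n → Fin 2`. -/
abbrev ChainMat (n : ℕ) : Type := Matrix (Fin n → Fin 2) (Fin n → Fin 2) ℂ

/-- The tensor product `M 0 ⊗ M 1 ⊗ ⋯ ⊗ M (n-1)` of `2 × 2` matrices. -/
def tensor {n : ℕ} (M : Fin n → Matrix (Fin 2) (Fin 2) ℂ) : ChainMat n :=
  Matrix.of fun p q => ∏ i, M i (p i) (q i)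

/-- `σ^j`: the matrix `σ` at site `j`, the identity at all the other sites. -/
def site {n : ℕ} (σ : Matrix (Fin 2) (Fin 2) ℂ) (j : Fin n) : ChainMat n :=
  tensor fun i => if i = j then σ else 1

/-- `H₀ = ∑_j σ_z^j σ_z^{j+1}`, with periodic boundary conditions
(`finRotate n` sends `j` to `j + 1` and the last site to the first). -/
noncomputable def H0 (n : ℕ) : ChainMat n :=
  ∑ j : Fin n, site sigmaZ j * site sigmaZ (finRotate n j)

/-- `H₁ = ∑_j σ_x^j`. -/
noncomputable def H1 (n : ℕ) : ChainMat n :=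
  ∑ j : Fin n, site sigmaX j

/-- The dynamical Lie algebra: the real Lie algebra generated by `iH₀` and `iH₁`. -/
noncomputable def dynamicalLieAlgebra (n : ℕ) : LieSubalgebra ℝ (ChainMat n) :=
  LieSubalgebra.lieSpan ℝ (ChainMat n) {Complex.I • H0 n, Complex.I • H1 n}

/-- The permutation matrix on `(ℂ²)^{⊗ n}` that permutes the tensor factors by `s`. -/
noncomputable def permOp {n : ℕ} (s : Equiv.Perm (Fin n)) : ChainMat n :=
  Equiv.Perm.permMatrix ℂ
    ((Equiv.arrowCongr s (Equiv.refl (Fin 2)) : Equiv.Perm (Fin n → Fin 2)))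

/-- The symmetrization `𝒞(A) = ∑_{P ∈ C_n} P A Pᵀ` over the cyclic group `C_n`, whose elements
are the powers `0, …, n - 1` of the cycle `(1 2 ⋯ n)`. -/
noncomputable def symmetrize {n : ℕ} (A : ChainMat n) : ChainMat n :=
  ∑ r ∈ Finset.range n, permOp (finRotate n ^ r) * A * (permOp (finRotate n ^ r))ᵀ

/-- `A ⊗ σ_x^{⊗ j} ⊗ B ⊗ 1^{⊗ (n-j-2)}`, used for `j ≤ n - 2`. -/
def block (n : ℕ) (A B : Matrix (Fin 2) (Fin 2) ℂ) (j : ℕ) : ChainMat n :=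
  tensor fun i : Fin n =>
    if i.val = 0 then A
    else if i.val ≤ j then sigmaX
    else if i.val = j + 1 then B
    else 1

/-- `𝐘^j = i 𝒞(σ_y ⊗ σ_x^{⊗ j} ⊗ σ_y ⊗ 1 ⊗ ⋯ ⊗ 1)`. -/
noncomputable def bY (n j : ℕ) : ChainMat n :=
  Complex.I • symmetrize (block n sigmaY sigmaY j)

/-- `𝐙^j = i 𝒞(σ_z ⊗ σ_x^{⊗ j} ⊗ σ_z ⊗ 1 ⊗ ⋯ ⊗ 1)`. -/
noncomputable def bZ (n j : ℕ) : ChainMat n :=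
  Complex.I • symmetrize (block n sigmaZ sigmaZ j)

/-- `𝐘𝐙^j = i 𝒞(σ_z ⊗ σ_x^{⊗ j} ⊗ σ_y ⊗ 1 ⊗ ⋯) + i 𝒞(σ_y ⊗ σ_x^{⊗ j} ⊗ σ_z ⊗ 1 ⊗ ⋯)`. -/
noncomputable def bYZ (n j : ℕ) : ChainMat n :=
  Complex.I • symmetrize (block n sigmaZ sigmaY j) +
    Complex.I • symmetrize (block n sigmaY sigmaZ j)

/-- `𝐗 = i 𝒞(σ_x ⊗ 1^{⊗ (n-1)})`. -/
noncomputable def bX (n : ℕ) : ChainMat n :=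
  Complex.I • symmetrize (tensor fun i : Fin n => if i.val = 0 then sigmaX else 1)

/-- `𝐗𝐗 = i 𝒞(σ_x^{⊗ (n-1)} ⊗ 1)`. -/
noncomputable def bXX (n : ℕ) : ChainMat n :=
  Complex.I • symmetrize (tensor fun i : Fin n => if i.val + 1 < n then sigmaX else 1)

/-- The polynomials `a_k(λ)`: `a_0 = 1` and `a_k = λ a_{k-1} - a_{k-2}` for `k ≥ 1`,
with `a_{-1} = 0`; hence `a_1 = λ`. -/
noncomputable def aPoly : ℕ → ℝ[X]
  | 0 => 1
  | 1 => X
  | (k + 2) => X * aPoly (k + 1) - aPoly k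

/-- The value of `a_k` at `lam`. -/
noncomputable def a (k : ℕ) (lam : ℝ) : ℝ := (aPoly k).eval lam

/-- `X̂ = a_0 (𝐗 + 𝐙^1) + a_{n-2} (𝐗𝐗 - 𝐘^{n-3}) + ∑_{k=1}^{n-3} a_k (𝐙^{k+1} - 𝐘^{k-1})`,
for `n ≥ 3`. -/
noncomputable def Xhat (n : ℕ) (lam : ℝ) : ChainMat n :=
  a 0 lam • (bX n + bZ n 1) + a (n - 2) lam • (bXX n - bY n (n - 3)) +
    ∑ k ∈ Finset.Icc 1 (n - 3), a k lam • (bZ n (k + 1) - bY n (k - 1))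

/-- `Ŷ = ∑_{k=0}^{n-2} a_k (𝐘^k - 𝐙^k)`. -/
noncomputable def Yhat (n : ℕ) (lam : ℝ) : ChainMat n :=
  ∑ k ∈ Finset.range (n - 1), a k lam • (bY n k - bZ n k)

/-- `Ẑ = ∑_{k=0}^{n-2} a_k 𝐘𝐙^k`. -/
noncomputable def Zhat (n : ℕ) (lam : ℝ) : ChainMat n :=
  ∑ k ∈ Finset.range (n - 1), a k lam • bYZ n k

/-- The real space spanned by `X̂`, `Ŷ`, `Ẑ`. -/
noncomputable def idealSpan (n : ℕ) (lam : ℝ) : Submodule ℝ (ChainMat n) :=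
  Submodule.span ℝ {Xhat n lam, Yhat n lam, Zhat n lam}

/-- The norm `‖A‖ = √(Tr(A A†) / (n 2ⁿ))` of the normalized trace inner product, for which `𝐗`,
`𝐗𝐗`, `𝐘^j`, `𝐙^j` are unit vectors. (`Tr(A A†)` is always real.) -/
noncomputable def traceNorm {n : ℕ} (A : ChainMat n) : ℝ :=
  Real.sqrt ((1 / ((n : ℝ) * 2 ^ n)) * (Matrix.trace (A * Aᴴ)).re)

/-- `S̃_x = X̂ + Ŷ`. -/
noncomputable def tildeSx (n : ℕ) (lam : ℝ) : ChainMat n := Xhat n lam + Yhat n lam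

/-- `S̃_y = X̂ - Ŷ`. -/
noncomputable def tildeSy (n : ℕ) (lam : ℝ) : ChainMat n := Xhat n lam - Yhat n lam

/-- `S_x = - S̃_x / (2 √(2 - λ) ‖S̃_x‖ ‖S̃_y‖)`. -/
noncomputable def Sx (n : ℕ) (lam : ℝ) : ChainMat n :=
  (-(1 / (2 * Real.sqrt (2 - lam) * traceNorm (tildeSx n lam) * traceNorm (tildeSy n lam)))) •
    tildeSx n lam

/-- `S_y = S̃_y / (2 √(2 - λ) ‖S̃_y‖²)`. -/
noncomputable def Sy (n : ℕ) (lam : ℝ) : ChainMat n :=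
  (1 / (2 * Real.sqrt (2 - lam) * traceNorm (tildeSy n lam) ^ 2)) • tildeSy n lam

/-- `S_z = Ẑ / (2 ‖S̃_x‖ ‖S̃_y‖)`. -/
noncomputable def Sz (n : ℕ) (lam : ℝ) : ChainMat n :=
  (1 / (2 * traceNorm (tildeSx n lam) * traceNorm (tildeSy n lam))) • Zhat n lam

/-- The real Lie algebra `su(N)` of traceless skew-Hermitian `N × N` complex matrices. -/
def su (N : ℕ) : LieSubalgebra ℝ (Matrix (Fin N) (Fin N) ℂ) where
  carrier := {A | Aᴴ = -A ∧ A.trace = 0}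
  zero_mem' := by simp
  add_mem' := by
    rintro A B ⟨hA, hA'⟩ ⟨hB, hB'⟩
    refine ⟨?_, ?_⟩
    · rw [Matrix.conjTranspose_add, hA, hB, neg_add]
    · rw [Matrix.trace_add, hA', hB', add_zero]
  smul_mem' := by
    rintro c A ⟨hA, hA'⟩
    refine ⟨?_, ?_⟩
    · rw [Matrix.conjTranspose_smul, hA, star_trivial, smul_neg]
    · rw [Matrix.trace_smul, hA', smul_zero]
  lie_mem' := by
    rintro A B ⟨hA, _⟩ ⟨hB, _⟩
    refine ⟨?_, ?_⟩
    · rw [Ring.lie_def, Matrix.conjTranspose_sub, Matrix.conjTranspose_mul,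
        Matrix.conjTranspose_mul, hA, hB]
      noncomm_ring
    · rw [Ring.lie_def, Matrix.trace_sub, Matrix.trace_mul_comm, sub_self]

end IsingChain

/-! Give the involution `σ_x^r` the index `2r` and `σ_z^r σ_z^{r+1}` the index `2r+1`. Then `H₁` is
the sum of the even bonds and `H₀` the sum of the odd ones, neighbouring bonds anticommute and all
others commute. The bracket of `H₁` or `H₀` with a product of consecutive bonds (a string) only
changes the two ends. Translation invariant sums of strings therefore give families `A m`, `G m` (`m
: ℤ`) with `A 0 = iH₁`, `A 1 = iH₀` that satisfy Onsager's relations, such as `⁅G m, A l⁆ = -4 (A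
(l+m) - A (l-m))`. Up to sign, `𝐗`, `𝐗𝐗`, `𝐘^j`, `𝐙^j` are members of `A`, and `𝐘𝐙^j` are members of
`G`.

A string once around the ring is the global flip `∏ σ_x` up to sign, whether it starts at bond 0 or
at bond 1. This gives `G n = 0`, and so `A (l+n) = A (l-n)`. Let `b 0 = 0`, `b 1 = 1`, `b (m+2) = -λ
b (m+1) - b m`; this is `b (k+1) = (-1)^k a_k`, and the root condition says `b n = 0`. Put `ζ = ∑ b
m G m` and `ψ l = ∑ b m (A (l+m) - A (l-m))`, the sums running over `m < n`. Summation by parts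
gives `ψ (l+1) + ψ (l-1) = -λ ψ l`, so `span {ψ 0, ψ 1, ζ}` is stable under the brackets with both
generators and is an ideal. It is the required space, because `X̂ = -ψ 1`, `Ŷ = -ψ 0`, `Ẑ = ζ`.

For the normalization, invariance of `-Tr(AB)/(n 2ⁿ)` determines the Gram matrix of `ψ 0, ψ 1, ζ` up
to one factor, which is fixed by `⟨𝐗, X̂⟩ = 1`. With `S = ∑ (b m)²` this yields `‖S̃_x‖² = 2(2-λ)S`
and `‖S̃_y‖² = 2(2+λ)S`. Positivity of the norm gives `|λ| ≤ 2`, and `a_k(±2) ≠ 0` makes this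
strict. The brackets then come down to scalar identities, and they force independence and the
isomorphism with `su 2` as soon as `S_z ≠ 0`. -/

namespace IsingChain

/-! ### Onsager's relations from the brackets with two generators. -/

section Onsager

variable {L : Type*} [LieRing L] [LieAlgebra ℝ L]

/-- Brackets of `A 0` and `A 1` with a double family `A`, `G`, from which the relations of the
Onsager algebra follow; `A'` is a second description of the family `A`. -/
structure OnsagerSeed (A A' G : ℤ → L) : Prop where
  lie_zero_A : ∀ m, ⁅A 0, A m⁆ = (-2 : ℝ) • G m
  lie_one_A : ∀ m, ⁅A 1, A m⁆ = (-2 : ℝ) • G (m - 1)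
  lie_zero_A' : ∀ m, ⁅A 0, A' m⁆ = (2 : ℝ) • G (-m)
  lie_one_A' : ∀ m, ⁅A 1, A' m⁆ = (2 : ℝ) • G (1 - m)
  lie_zero_G : ∀ m, ⁅A 0, G m⁆ = (4 : ℝ) • (A m - A' (-m))
  lie_one_G : ∀ m, ⁅A 1, G m⁆ = (4 : ℝ) • (A (m + 1) - A' (1 - m))
  zero : A' 0 = A 0
  one : A' 1 = A 1

namespace OnsagerSeed

variable {A A' G : ℤ → L} (h : OnsagerSeed A A' G)

include h

lemma G_one : G 1 = (1 / 2 : ℝ) • ⁅A 1, A 0⁆ := by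
  rw [← lie_skew, h.lie_zero_A]; module

/-- By Jacobi, since `G 1` is a multiple of `⁅A 1, A 0⁆`. The terms in `A'` from the two orders
cancel, so the result involves `A` alone. -/
lemma lie_G_one_A (m : ℤ) : ⁅G 1, A m⁆ = (-4 : ℝ) • (A (m + 1) - A (m - 1)) := by
  rw [h.G_one, smul_lie, lie_lie, h.lie_zero_A, h.lie_one_A, lie_smul, lie_smul, h.lie_one_G,
    h.lie_zero_G, neg_sub]
  module

lemma lie_G_one_A' (m : ℤ) : ⁅G 1, A' m⁆ = (-4 : ℝ) • (A' (m + 1) - A' (m - 1)) := by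
  rw [h.G_one, smul_lie, lie_lie, h.lie_zero_A', h.lie_one_A', lie_smul, lie_smul, h.lie_one_G,
    h.lie_zero_G, neg_sub, show (1 : ℤ) - -m = m + 1 by ring, show -m + 1 = 1 - m by ring]
  module

omit h in
/-- Two-sided induction with a two-step hypothesis. -/
lemma int_two_step {P : ℤ → Prop} (h0 : P 0) (h1 : P 1)
    (up : ∀ m, P (m - 1) → P m → P (m + 1)) (down : ∀ m, P (m + 1) → P m → P (m - 1)) (m : ℤ) :
    P m := by
  suffices H : P m ∧ P (m + 1) from H.1
  induction m using Int.induction_on with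
  | zero => exact ⟨h0, by simpa using h1⟩
  | succ i ih => exact ⟨ih.2, up _ (by simpa using ih.1) ih.2⟩
  | pred i ih => exact ⟨down _ ih.2 ih.1, by simpa using ih.1⟩

/-- Bracketing with `G 1` yields the same two-step recursion for both families, and they agree at 0
and 1. The two descriptions thus merge without any computation with strings. -/
lemma A'_eq (m : ℤ) : A' m = A m := by
  induction m using int_two_step with
  | h0 => exact h.zero
  | h1 => exact h.one
  | up m h1 h2 =>
    have e1 := h.lie_G_one_A m
    have e2 := h.lie_G_one_A' m
    rw [h2, e1, h1] at e2
    have := smul_right_injective L (by norm_num : (-4 : ℝ) ≠ 0) e2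
    exact (sub_left_inj.1 this).symm
  | down m h1 h2 =>
    have e1 := h.lie_G_one_A m
    have e2 := h.lie_G_one_A' m
    rw [h2, e1, h1] at e2
    have := smul_right_injective L (by norm_num : (-4 : ℝ) ≠ 0) e2
    exact (sub_right_inj.1 this).symm

lemma G_neg (m : ℤ) : G (-m) = -G m := by
  have e1 := h.lie_zero_A m
  have e2 := h.lie_zero_A' m
  rw [h.A'_eq, e1] at e2
  have : (2 : ℝ) • G (-m) = (2 : ℝ) • (-G m) := by rw [← e2]; module
  exact smul_right_injective L (by norm_num : (2 : ℝ) ≠ 0) this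

lemma G_zero : G 0 = 0 := by
  have e1 := h.lie_zero_A 0
  rw [lie_self] at e1
  exact (smul_eq_zero.1 e1.symm).resolve_left (by norm_num)

lemma lie_G_one_G (m : ℤ) : ⁅G 1, G m⁆ = 0 := by
  rw [h.G_one, smul_lie, lie_lie, h.lie_zero_G, h.lie_one_G, lie_smul, lie_smul, lie_sub, lie_sub,
    h.A'_eq, h.A'_eq, h.lie_zero_A, h.lie_one_A, h.lie_zero_A, h.lie_one_A,
    show -m - 1 = -(m + 1) by ring, show 1 - m = -(m - 1) by ring, h.G_neg, h.G_neg]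
  module

/-- `G 1` commutes with `G m`, so `l ↦ ⁅G m, A l⁆` inherits from `A` its two-step recursion in `l`;
the cases `l = 0, 1` are part of the seed. -/
lemma lie_G_A (m l : ℤ) : ⁅G m, A l⁆ = (-4 : ℝ) • (A (l + m) - A (l - m)) := by
  have key : ∀ l, ⁅G m, A (l + 1)⁆ = ⁅G m, A (l - 1)⁆ - (1 / 4 : ℝ) • ⁅G 1, ⁅G m, A l⁆⁆ := by
    intro l
    have e : ⁅G 1, ⁅G m, A l⁆⁆ = ⁅G m, ⁅G 1, A l⁆⁆ := by
      rw [leibniz_lie, h.lie_G_one_G, zero_lie, zero_add]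
    rw [e, h.lie_G_one_A, lie_smul, lie_sub]
    module
  induction l using int_two_step with
  | h0 =>
    rw [← lie_skew, h.lie_zero_G, h.A'_eq, zero_add, zero_sub]; module
  | h1 =>
    rw [← lie_skew, h.lie_one_G, h.A'_eq, add_comm m 1]; module
  | up l h1 h2 =>
    rw [key, h1, h2, lie_smul, lie_sub, h.lie_G_one_A, h.lie_G_one_A,
      show l + m - 1 = l - 1 + m by ring, show l + m + 1 = l + 1 + m by ring,
      show l - m - 1 = l - 1 - m by ring, show l - m + 1 = l + 1 - m by ring]
    module
  | down l h1 h2 =>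
    have := key l
    rw [h1, h2, lie_smul, lie_sub, h.lie_G_one_A, h.lie_G_one_A] at this
    rw [eq_sub_iff_add_eq] at this
    rw [← this, show l + m - 1 = l - 1 + m by ring, show l + m + 1 = l + 1 + m by ring,
      show l - m - 1 = l - 1 - m by ring, show l - m + 1 = l + 1 - m by ring]
    module

lemma A_mem (K : LieSubalgebra ℝ L) (h0 : A 0 ∈ K) (h1 : A 1 ∈ K) (m : ℤ) : A m ∈ K := by
  have hG : G 1 ∈ K := by rw [h.G_one]; exact K.smul_mem _ (K.lie_mem h1 h0)
  induction m using int_two_step with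
  | h0 => exact h0
  | h1 => exact h1
  | up m e1 e2 =>
    have : A (m + 1) = A (m - 1) - (1 / 4 : ℝ) • ⁅G 1, A m⁆ := by rw [h.lie_G_one_A]; module
    rw [this]
    exact K.sub_mem e1 (K.smul_mem _ (K.lie_mem hG e2))
  | down m e1 e2 =>
    have : A (m - 1) = A (m + 1) + (1 / 4 : ℝ) • ⁅G 1, A m⁆ := by rw [h.lie_G_one_A]; module
    rw [this]
    exact K.add_mem e1 (K.smul_mem _ (K.lie_mem hG e2))

lemma G_mem (K : LieSubalgebra ℝ L) (h0 : A 0 ∈ K) (h1 : A 1 ∈ K) (m : ℤ) : G m ∈ K := by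
  have : G m = (-1 / 2 : ℝ) • ⁅A 0, A m⁆ := by rw [h.lie_zero_A]; module
  rw [this]
  exact K.smul_mem _ (K.lie_mem h0 (h.A_mem K h0 h1 m))

end OnsagerSeed

/-- A Chebyshev type recursion with initial values `0`, `1`. -/
structure ChebSeq (b : ℕ → ℝ) (lam : ℝ) : Prop where
  zero : b 0 = 0
  one : b 1 = 1
  add_two : ∀ m, b (m + 2) = -lam * b (m + 1) - b m

lemma ChebSeq.eq_smul {V : Type*} [AddCommGroup V] [Module ℝ V] {b : ℕ → ℝ} {lam : ℝ}
    (hb : ChebSeq b lam) (D : ℕ → V) (h0 : D 0 = 0)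
    (hD : ∀ m, D (m + 2) = -lam • D (m + 1) - D m) (m : ℕ) : D m = b m • D 1 := by
  induction m using Nat.twoStepInduction with
  | zero => rw [h0, hb.zero, zero_smul]
  | one => rw [hb.one, one_smul]
  | more m h1 h2 => rw [hD, h2, h1, hb.add_two]; module

/-- The recursion is symmetric in the two shifts, so they can be moved from `D` to `b`. The boundary
terms vanish because `b` and `D` are both zero at 0 and at `n`. -/
lemma ChebSeq.sum_by_parts {V : Type*} [AddCommGroup V] [Module ℝ V] {b : ℕ → ℝ} {lam : ℝ}
    (hb : ChebSeq b lam) (D : ℤ → V) (h0 : D 0 = 0) {n : ℕ} (hn : 0 < n) (hbn : b n = 0)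
    (hDn : D n = 0) :
    ∑ m ∈ Finset.range n, b m • (D (m + 1) + D (m - 1)) =
      -lam • ∑ m ∈ Finset.range n, b m • D m := by
  have key : ∀ N : ℕ, ∑ m ∈ Finset.range (N + 1), b m • (D (m + 1) + D (m - 1)) =
      -lam • ∑ m ∈ Finset.range (N + 1), b m • D m + b N • D (N + 1 : ℕ) - b (N + 1) • D N := by
    intro N
    induction N with
    | zero => simp [hb.zero, h0]
    | succ N ih =>
      rw [Finset.sum_range_succ, ih, Finset.sum_range_succ (fun m : ℕ => b m • D m) (N + 1),
        hb.add_two]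
      push_cast
      rw [add_sub_cancel_right]
      module
  obtain ⟨N, rfl⟩ : ∃ N, n = N + 1 := ⟨n - 1, by omega⟩
  rw [key, hbn, hDn]; simp

/-! ### The component at a root when `G n = 0`. -/

namespace OnsagerSeed

variable {A A' G : ℤ → L} (h : OnsagerSeed A A' G)
variable {b : ℕ → ℝ} {lam : ℝ} (hb : ChebSeq b lam) {n : ℕ} (hn : 0 < n) (hbn : b n = 0)
  (hG : G n = 0)

/-- The component at `lam` of the family `A`. -/
def psi (A : ℤ → L) (b : ℕ → ℝ) (n : ℕ) (l : ℤ) : L :=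
  ∑ m ∈ Finset.range n, b m • (A (l + m) - A (l - m))

/-- The component at `lam` of the family `G`. -/
def zeta (G : ℤ → L) (b : ℕ → ℝ) (n : ℕ) : L :=
  ∑ m ∈ Finset.range n, b m • G m

include h

lemma lie_zeta_A (b : ℕ → ℝ) (n : ℕ) (l : ℤ) : ⁅zeta G b n, A l⁆ = (-4 : ℝ) • psi A b n l := by
  rw [zeta, psi, sum_lie, Finset.smul_sum]
  refine Finset.sum_congr rfl fun m _ => ?_
  rw [smul_lie, h.lie_G_A]; module

lemma lie_zero_zeta (b : ℕ → ℝ) (n : ℕ) : ⁅A 0, zeta G b n⁆ = (4 : ℝ) • psi A b n 0 := by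
  rw [← lie_skew, h.lie_zeta_A]; module

lemma lie_one_zeta (b : ℕ → ℝ) (n : ℕ) : ⁅A 1, zeta G b n⁆ = (4 : ℝ) • psi A b n 1 := by
  rw [← lie_skew, h.lie_zeta_A]; module

lemma lie_zero_psi_zero (b : ℕ → ℝ) (n : ℕ) :
    ⁅A 0, psi A b n 0⁆ = (-4 : ℝ) • zeta G b n := by
  rw [zeta, psi, lie_sum, Finset.smul_sum]
  refine Finset.sum_congr rfl fun m _ => ?_
  rw [lie_smul, lie_sub, h.lie_zero_A, h.lie_zero_A, zero_add, zero_sub, h.G_neg]; module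

lemma lie_one_psi_one (b : ℕ → ℝ) (n : ℕ) :
    ⁅A 1, psi A b n 1⁆ = (-4 : ℝ) • zeta G b n := by
  rw [zeta, psi, lie_sum, Finset.smul_sum]
  refine Finset.sum_congr rfl fun m _ => ?_
  rw [lie_smul, lie_sub, h.lie_one_A, h.lie_one_A, add_sub_cancel_left, sub_sub_cancel_left,
    h.G_neg]
  module

include hb hn hbn hG

/-- Here `G (m+1) + G (m-1)` appears under the sum; summation by parts with `G 0 = G n = 0` turns it
into `-lam` times `zeta`. -/
lemma lie_zero_psi_one : ⁅A 0, psi A b n 1⁆ = (2 * lam) • zeta G b n := by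
  have := hb.sum_by_parts G h.G_zero hn hbn hG
  rw [zeta, psi, lie_sum, show 2 * lam = (-2 : ℝ) * (-lam) by ring, mul_smul, ← this,
    Finset.smul_sum]
  refine Finset.sum_congr rfl fun m _ => ?_
  rw [lie_smul, lie_sub, h.lie_zero_A, h.lie_zero_A, show (1 : ℤ) - m = -(m - 1) by ring, h.G_neg,
    add_comm (1 : ℤ)]
  module

lemma lie_one_psi_zero : ⁅A 1, psi A b n 0⁆ = (2 * lam) • zeta G b n := by
  have := hb.sum_by_parts G h.G_zero hn hbn hG
  rw [zeta, psi, lie_sum, show 2 * lam = (-2 : ℝ) * (-lam) by ring, mul_smul, ← this,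
    Finset.smul_sum]
  refine Finset.sum_congr rfl fun m _ => ?_
  rw [lie_smul, lie_sub, h.lie_one_A, h.lie_one_A, show (0 : ℤ) - m - 1 = -(m + 1) by ring, h.G_neg,
    zero_add]
  module

omit hb hn hbn in
lemma A_periodic (l : ℤ) : A (l + n) = A (l - n) := by
  have := h.lie_G_A n l
  rw [hG, zero_lie] at this
  exact sub_eq_zero.1 ((smul_eq_zero.1 this.symm).resolve_left (by norm_num))

/-- Summation by parts for `m ↦ A (l+m) - A (l-m)`, which vanishes at `m = n` by periodicity. All
`psi` lie in the span of `psi 0` and `psi 1`. -/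
lemma psi_rec (l : ℤ) : psi A b n (l + 1) = -lam • psi A b n l - psi A b n (l - 1) := by
  have := hb.sum_by_parts (fun m => A (l + m) - A (l - m)) (by simp) hn hbn
    (sub_eq_zero.2 (h.A_periodic hG l))
  rw [eq_sub_iff_add_eq, psi, psi, psi, ← this, ← Finset.sum_add_distrib]
  refine Finset.sum_congr rfl fun m _ => ?_
  rw [show l + 1 + (m : ℤ) = l + (m + 1) by ring, show l + 1 - (m : ℤ) = l - (m - 1) by ring,
    show l - 1 + (m : ℤ) = l + (m - 1) by ring, show l - 1 - (m : ℤ) = l - (m + 1) by ring]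
  module

lemma lie_zeta_psi (l : ℤ) : ⁅zeta G b n, psi A b n l⁆ =
    (-4 * ∑ m ∈ Finset.range n, b m ^ 2) • (psi A b n (l + 1) - psi A b n (l - 1)) := by
  -- As a function of `m` the left side obeys the recursion of `b` and vanishes at 0, hence is `b m`
  -- times its value at 1. The second factor `b m` in `∑ b m ^ 2` comes from here.
  have key : ∀ m : ℕ, psi A b n (l + m) - psi A b n (l - m) =
      b m • (psi A b n (l + 1) - psi A b n (l - 1)) := by
    intro m
    have := hb.eq_smul (fun m : ℕ => psi A b n (l + m) - psi A b n (l - m)) (by simp) (fun m => by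
      have e1 := h.psi_rec hb hn hbn hG (l + (m + 1 : ℕ))
      have e2 := h.psi_rec hb hn hbn hG (l - (m + 1 : ℕ))
      push_cast at e1 e2 ⊢
      rw [show l + ((m : ℤ) + 1) - 1 = l + m by ring] at e1
      rw [show l - ((m : ℤ) + 1) - 1 = l - (m + 2) by ring,
        show l - ((m : ℤ) + 1) + 1 = l - m by ring] at e2
      rw [show l + ((m : ℤ) + 2) = l + (m + 1) + 1 by ring, e1, e2]
      module) m
    simpa using this
  conv_lhs => rw [psi]
  rw [lie_sum, mul_smul, Finset.sum_smul, Finset.smul_sum]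
  refine Finset.sum_congr rfl fun m _ => ?_
  rw [lie_smul, lie_sub, h.lie_zeta_A, h.lie_zeta_A, ← smul_sub, key]
  module

lemma lie_zeta_psi_zero : ⁅zeta G b n, psi A b n 0⁆ =
    (-4 * ∑ m ∈ Finset.range n, b m ^ 2) • ((2 : ℝ) • psi A b n 1 + lam • psi A b n 0) := by
  rw [h.lie_zeta_psi hb hn hbn hG]
  have := h.psi_rec hb hn hbn hG 0
  rw [this]
  rw [zero_add] at this
  rw [this]
  module

lemma lie_zeta_psi_one : ⁅zeta G b n, psi A b n 1⁆ =
    (4 * ∑ m ∈ Finset.range n, b m ^ 2) • (lam • psi A b n 1 + (2 : ℝ) • psi A b n 0) := by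
  rw [h.lie_zeta_psi hb hn hbn hG, h.psi_rec hb hn hbn hG 1, sub_self]
  module

lemma lie_psi_one_psi_zero : ⁅psi A b n 1, psi A b n 0⁆ =
    (2 * (4 - lam ^ 2) * ∑ m ∈ Finset.range n, b m ^ 2) • zeta G b n := by
  -- The bracket wanted is extracted from the derivation rule: `⁅A 1, zeta⁆` is `4 psi 1`, while `⁅A
  -- 1, psi 0⁆` is a multiple of `zeta` and drops out.
  have e := leibniz_lie (A 1) (zeta G b n) (psi A b n 0)
  rw [h.lie_zeta_psi_zero hb hn hbn hG, h.lie_one_psi_zero hb hn hbn hG, lie_smul (2 * lam),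
    lie_self, smul_zero, add_zero, h.lie_one_zeta, lie_smul, lie_add, lie_smul, lie_smul,
    h.lie_one_psi_one, h.lie_one_psi_zero hb hn hbn hG, smul_lie] at e
  have : ⁅psi A b n 1, psi A b n 0⁆ = (1 / 4 : ℝ) • (4 : ℝ) • ⁅psi A b n 1, psi A b n 0⁆ := by
    module
  rw [this, ← e]
  module

end OnsagerSeed

end Onsager

end IsingChain

/-! ### Strings of involutions and the bond algebra. -/

namespace IsingChain

/-- The products `u 0 * ⋯ * u (k - 1)`, extended to negative `k` such that
`intProd u (k + 1) = intProd u k * u k`. -/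
def intProd {Γ : Type*} [Group Γ] (u : ℤ → Γ) : ℤ → Γ
  | .ofNat k => ((List.range k).map fun i : ℕ => u i).prod
  | .negSucc k => ((List.range (k + 1)).map fun i : ℕ => (u (-(i + 1)))⁻¹).prod

lemma intProd_add_one {Γ : Type*} [Group Γ] (u : ℤ → Γ) (k : ℤ) :
    intProd u (k + 1) = intProd u k * u k := by
  rcases k with k | k
  · change intProd u (.ofNat (k + 1)) = _
    simp [intProd, List.range_succ]
  · rcases k with _ | k
    · change intProd u (.ofNat 0) = _
      simp [intProd]
    · change intProd u (.negSucc k) = _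
      simp only [intProd]
      rw [List.range_succ (n := k + 1), List.map_append, List.prod_append, mul_assoc]
      simp [Int.negSucc_eq]

lemma sum_range_shift {M : Type*} [AddCommGroup M] {n : ℕ} {f : ℤ → M}
    (hf : ∀ r, f (r + n) = f r) (s : ℤ) :
    ∑ r ∈ Finset.range n, f (r + s) = ∑ r ∈ Finset.range n, f r := by
  have one : ∀ g : ℤ → M, (∀ r, g (r + n) = g r) →
      ∑ r ∈ Finset.range n, g (r + 1) = ∑ r ∈ Finset.range n, g r := by
    intro g hg
    have := Finset.sum_range_succ' (fun r : ℕ => g r) n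
    rw [Finset.sum_range_succ] at this
    have h0 := hg 0
    rw [zero_add] at h0
    simp only [Nat.cast_add, Nat.cast_one, Nat.cast_zero, h0] at this
    exact (add_right_cancel this).symm
  induction s using Int.induction_on with
  | zero => simp
  | succ i ih =>
    rw [← ih, ← one (fun r => f (r + i)) (fun r => by rw [add_right_comm, hf])]
    exact Finset.sum_congr rfl fun r _ => by ring_nf
  | pred i ih =>
    rw [← ih, ← one (fun r => f (r + (-i - 1))) (fun r => by rw [add_right_comm, hf])]
    exact Finset.sum_congr rfl fun r _ => by ring_nf

lemma sum_range_neg {M : Type*} [AddCommGroup M] {n : ℕ} {f : ℤ → M}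
    (hf : ∀ r, f (r + n) = f r) :
    ∑ r ∈ Finset.range n, f (-r) = ∑ r ∈ Finset.range n, f r := by
  rw [← sum_range_shift hf 1, ← Finset.sum_range_reflect]
  refine Finset.sum_congr rfl fun r hr => ?_
  have := Finset.mem_range.1 hr
  rw [← hf, Nat.cast_sub (by omega), Nat.cast_sub (by omega)]
  congr 1
  push_cast
  ring

section Strings

variable {R : Type*} [Ring R]

/-- The string `e j * e (j + 1) * ⋯ * e (k - 1)` of involutions `e i`, where `j`, `k` may be
any integers. -/
def str (e : ℤ → R) (he : ∀ k, e k * e k = 1) (j k : ℤ) : R :=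
  (((intProd (fun i => (⟨e i, e i, he i, he i⟩ : Rˣ)) j)⁻¹ *
    intProd (fun i => (⟨e i, e i, he i, he i⟩ : Rˣ)) k : Rˣ) : R)

variable {e : ℤ → R} (he : ∀ k, e k * e k = 1)

lemma str_self (j : ℤ) : str e he j j = 1 := by simp [str]

lemma str_succ (j k : ℤ) : str e he j (k + 1) = str e he j k * e k := by
  simp [str, intProd_add_one, mul_assoc]

lemma str_pred (j k : ℤ) : str e he j (k - 1) = str e he j k * e (k - 1) := by
  have := str_succ he j (k - 1)
  rw [sub_add_cancel] at this
  rw [this, mul_assoc, he, mul_one]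

lemma succ_str (j k : ℤ) : str e he (j + 1) k = e j * str e he j k := by
  simp [str, intProd_add_one, mul_assoc]

lemma pred_str (j k : ℤ) : str e he (j - 1) k = e (j - 1) * str e he j k := by
  have := succ_str he (j - 1) k
  rw [sub_add_cancel] at this
  rw [this, ← mul_assoc, he, one_mul]

lemma str_add_one (j : ℤ) : str e he j (j + 1) = e j := by
  rw [str_succ, str_self, one_mul]

lemma str_add_one' (j : ℤ) : str e he (j + 1) j = e j := by
  rw [succ_str, str_self, mul_one]

lemma map_str (φ : R →* R) (s : ℤ) (hφ : ∀ k, φ (e k) = e (k + s)) (j k : ℤ) :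
    φ (str e he j k) = str e he (j + s) (k + s) := by
  induction k using Int.inductionOn' (b := j) with
  | zero => simp [str_self]
  | succ k _ ih => rw [str_succ, map_mul, ih, hφ, ← str_succ, add_right_comm]
  | pred k _ ih =>
    rw [str_pred, map_mul, ih, hφ, show k - 1 + s = k + s - 1 by ring, ← str_pred]

lemma intertwine_str (T : ℤ → R) (hT : ∀ k, T k * e k = e k * T (k + 1)) (j k : ℤ) :
    T j * str e he j k = str e he j k * T k := by
  induction k using Int.inductionOn' (b := j) with
  | zero => simp [str_self]
  | succ k _ ih => rw [str_succ, ← mul_assoc, ih, mul_assoc, hT, mul_assoc]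
  | pred k _ ih =>
    have h1 : T k * e (k - 1) = e (k - 1) * T (k - 1) := by
      have := hT (k - 1)
      rw [sub_add_cancel] at this
      calc T k * e (k - 1) = e (k - 1) * (e (k - 1) * T k) * e (k - 1) := by
            rw [← mul_assoc, he, one_mul]
        _ = _ := by rw [← this, mul_assoc, mul_assoc, he, mul_one]
    rw [str_pred, ← mul_assoc, ih, mul_assoc, h1, mul_assoc]

variable [Algebra ℝ R]

/-- The hypothesis says that `H - 2 t k` times `e k` equals `e k` times `H - 2 t (k+1)`. Passing `H
- 2 t` through the string telescopes, and only the two ends contribute. -/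
lemma lie_str (H : R) (t : ℤ → R) (hH : ∀ k, ⁅H, e k⁆ = (2 : ℝ) • (t k * e k - e k * t (k + 1)))
    (j k : ℤ) : ⁅H, str e he j k⁆ = (2 : ℝ) • (t j * str e he j k - str e he j k * t k) := by
  have := intertwine_str he (fun k => H - (2 : ℝ) • t k) (fun k => by
    have h1 := hH k
    rw [Ring.lie_def] at h1
    rw [sub_mul, mul_sub, smul_mul_assoc, mul_smul_comm, sub_eq_sub_iff_sub_eq_sub, h1]
    module) j k
  rw [sub_mul, mul_sub, smul_mul_assoc, mul_smul_comm, sub_eq_sub_iff_sub_eq_sub] at this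
  rw [Ring.lie_def, this]
  module

/-- Involutions `e k`, periodic in `k` with period `2 n`, such that the sums over the even and over
the odd indices have the same brackets with the `e k` as if neighbours anticommute and all other
pairs commute. -/
structure BondAlgebra (n : ℕ) (e : ℤ → R) : Prop where
  mul_self : ∀ k, e k * e k = 1
  periodic : ∀ k, e (k + 2 * n) = e k
  even_even : ∀ r : ℤ, ⁅∑ s ∈ Finset.range n, e (2 * s), e (2 * r)⁆ = 0
  even_odd : ∀ r : ℤ, ⁅∑ s ∈ Finset.range n, e (2 * s), e (2 * r + 1)⁆ =
    (2 : ℝ) • (e (2 * r) * e (2 * r + 1) - e (2 * r + 1) * e (2 * r + 2))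
  odd_odd : ∀ r : ℤ, ⁅∑ s ∈ Finset.range n, e (2 * s + 1), e (2 * r + 1)⁆ = 0
  odd_even : ∀ r : ℤ, ⁅∑ s ∈ Finset.range n, e (2 * s + 1), e (2 * r)⁆ =
    (2 : ℝ) • (e (2 * r - 1) * e (2 * r) - e (2 * r) * e (2 * r + 1))

namespace BondAlgebra

variable {n : ℕ} {e : ℤ → R} (h : BondAlgebra n e)

include h

lemma lie_even_str (j k : ℤ) : ⁅∑ s ∈ Finset.range n, e (2 * s), str e h.mul_self j k⁆ =
    (2 : ℝ) • (e (2 * (j / 2)) * str e h.mul_self j k -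
      str e h.mul_self j k * e (2 * (k / 2))) := by
  -- `t k` is the bond at the largest even index not exceeding `k`. Crossing an even bond leaves it
  -- unchanged, in agreement with the zero bracket.
  refine lie_str h.mul_self _ (fun k => e (2 * (k / 2))) (fun k => ?_) j k
  rcases Int.even_or_odd' k with ⟨r, rfl | rfl⟩
  · rw [h.even_even, show 2 * r / 2 = r by omega, show (2 * r + 1) / 2 = r by omega, sub_self,
      smul_zero]
  · rw [h.even_odd, show (2 * r + 1) / 2 = r by omega,
      show 2 * ((2 * r + 1 + 1) / 2) = 2 * r + 2 by omega]

lemma lie_odd_str (j k : ℤ) : ⁅∑ s ∈ Finset.range n, e (2 * s + 1), str e h.mul_self j k⁆ =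
    (2 : ℝ) • (e (2 * ((j + 1) / 2) - 1) * str e h.mul_self j k -
      str e h.mul_self j k * e (2 * ((k + 1) / 2) - 1)) := by
  refine lie_str h.mul_self _ (fun k => e (2 * ((k + 1) / 2) - 1)) (fun k => ?_) j k
  rcases Int.even_or_odd' k with ⟨r, rfl | rfl⟩
  · rw [h.odd_even, show 2 * ((2 * r + 1) / 2) - 1 = 2 * r - 1 by omega,
      show 2 * ((2 * r + 1 + 1) / 2) - 1 = 2 * r + 1 by omega]
  · rw [h.odd_odd, show 2 * ((2 * r + 1 + 1) / 2) - 1 = 2 * r + 1 by omega,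
      show 2 * ((2 * r + 1 + 1 + 1) / 2) - 1 = 2 * r + 1 by omega, sub_self, smul_zero]

/-- An end term repeats the first bond of the string and cancels it, or is the bond just before and
prolongs the string. This and the next seven lemmas list the cases by side and parity. -/
lemma even_mul_str (r k : ℤ) : e (2 * (2 * r / 2)) * str e h.mul_self (2 * r) k =
    str e h.mul_self (2 * r + 1) k := by
  rw [show 2 * (2 * r / 2) = 2 * r by omega, ← succ_str]

lemma even_mul_str' (r k : ℤ) : e (2 * ((2 * r + 1) / 2)) * str e h.mul_self (2 * r + 1) k =
    str e h.mul_self (2 * r) k := by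
  have := pred_str h.mul_self (2 * r + 1) k
  rw [add_sub_cancel_right] at this
  rw [show 2 * ((2 * r + 1) / 2) = 2 * r by omega, ← this]

lemma str_mul_even (r k : ℤ) : str e h.mul_self k (2 * r) * e (2 * (2 * r / 2)) =
    str e h.mul_self k (2 * r + 1) := by
  rw [show 2 * (2 * r / 2) = 2 * r by omega, ← str_succ]

lemma str_mul_even' (r k : ℤ) : str e h.mul_self k (2 * r + 1) * e (2 * ((2 * r + 1) / 2)) =
    str e h.mul_self k (2 * r) := by
  have := str_pred h.mul_self k (2 * r + 1)
  rw [add_sub_cancel_right] at this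
  rw [show 2 * ((2 * r + 1) / 2) = 2 * r by omega, ← this]

lemma odd_mul_str (r k : ℤ) : e (2 * ((2 * r + 1) / 2) - 1) * str e h.mul_self (2 * r) k =
    str e h.mul_self (2 * r - 1) k := by
  rw [show 2 * ((2 * r + 1) / 2) = 2 * r by omega, ← pred_str]

lemma odd_mul_str' (r k : ℤ) :
    e (2 * ((2 * r + 1 + 1) / 2) - 1) * str e h.mul_self (2 * r + 1) k =
      str e h.mul_self (2 * r + 2) k := by
  rw [show 2 * ((2 * r + 1 + 1) / 2) - 1 = 2 * r + 1 by omega, ← succ_str]; ring_nf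

lemma str_mul_odd (r k : ℤ) : str e h.mul_self k (2 * r) * e (2 * ((2 * r + 1) / 2) - 1) =
    str e h.mul_self k (2 * r - 1) := by
  rw [show 2 * ((2 * r + 1) / 2) = 2 * r by omega, ← str_pred]

lemma str_mul_odd' (r k : ℤ) :
    str e h.mul_self k (2 * r + 1) * e (2 * ((2 * r + 1 + 1) / 2) - 1) =
      str e h.mul_self k (2 * r + 2) := by
  rw [show 2 * ((2 * r + 1 + 1) / 2) - 1 = 2 * r + 1 by omega, ← str_succ]; ring_nf

lemma str_periodic (j k : ℤ) :
    str e h.mul_self (j + 2 * n) (k + 2 * n) = str e h.mul_self j k :=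
  (map_str h.mul_self (MonoidHom.id R) (2 * n) (fun k => (h.periodic k).symm) j k).symm

/-- The translation invariant sum of the strings from `2 r + j` to `2 r + k`. -/
def strSum (h : BondAlgebra n e) (j k : ℤ) : R :=
  ∑ r ∈ Finset.range n, str e h.mul_self (2 * r + j) (2 * r + k)

lemma strSum_shift (s j k : ℤ) : h.strSum (j + 2 * s) (k + 2 * s) = h.strSum j k := by
  have := sum_range_shift (n := n) (f := fun r => str e h.mul_self (2 * r + j) (2 * r + k))
    (fun r => by
      have := h.str_periodic (2 * r + j) (2 * r + k)
      rw [← this]; ring_nf) s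
  rw [strSum, strSum, ← this]
  exact Finset.sum_congr rfl fun r _ => by ring_nf

/-- Each of the two terms moves one end by one bond. Odd-to-even strings will give `A`, even-to-odd
ones `A'`, and strings with ends of equal parity `G`. -/
lemma lie_even_strSum_odd_even (m : ℤ) :
    ⁅∑ s ∈ Finset.range n, e (2 * s), h.strSum 1 (2 * m)⁆ =
      (2 : ℝ) • (h.strSum 0 (2 * m) - h.strSum 1 (2 * m + 1)) := by
  rw [strSum, strSum, strSum, lie_sum, ← Finset.sum_sub_distrib, Finset.smul_sum]
  refine Finset.sum_congr rfl fun r _ => ?_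
  rw [h.lie_even_str, h.even_mul_str', ← mul_add, h.str_mul_even]
  ring_nf

lemma lie_odd_strSum_odd_even (m : ℤ) :
    ⁅∑ s ∈ Finset.range n, e (2 * s + 1), h.strSum 1 (2 * m)⁆ =
      (2 : ℝ) • (h.strSum 2 (2 * m) - h.strSum 1 (2 * m - 1)) := by
  rw [strSum, strSum, strSum, lie_sum, ← Finset.sum_sub_distrib, Finset.smul_sum]
  refine Finset.sum_congr rfl fun r _ => ?_
  rw [h.lie_odd_str, h.odd_mul_str', ← mul_add, h.str_mul_odd]
  ring_nf

lemma lie_even_strSum_even_odd (m : ℤ) :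
    ⁅∑ s ∈ Finset.range n, e (2 * s), h.strSum (2 * m) 1⁆ =
      (2 : ℝ) • (h.strSum (2 * m + 1) 1 - h.strSum (2 * m) 0) := by
  rw [strSum, strSum, strSum, lie_sum, ← Finset.sum_sub_distrib, Finset.smul_sum]
  refine Finset.sum_congr rfl fun r _ => ?_
  rw [h.lie_even_str, h.str_mul_even', ← mul_add, h.even_mul_str]
  ring_nf

lemma lie_odd_strSum_even_odd (m : ℤ) :
    ⁅∑ s ∈ Finset.range n, e (2 * s + 1), h.strSum (2 * m) 1⁆ =
      (2 : ℝ) • (h.strSum (2 * m - 1) 1 - h.strSum (2 * m) 2) := by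
  rw [strSum, strSum, strSum, lie_sum, ← Finset.sum_sub_distrib, Finset.smul_sum]
  refine Finset.sum_congr rfl fun r _ => ?_
  rw [h.lie_odd_str, h.str_mul_odd', ← mul_add, h.odd_mul_str]
  ring_nf

lemma lie_even_strSum_even_even (m : ℤ) :
    ⁅∑ s ∈ Finset.range n, e (2 * s), h.strSum 0 (2 * m)⁆ =
      (2 : ℝ) • (h.strSum 1 (2 * m) - h.strSum 0 (2 * m + 1)) := by
  rw [strSum, strSum, strSum, lie_sum, ← Finset.sum_sub_distrib, Finset.smul_sum]
  refine Finset.sum_congr rfl fun r _ => ?_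
  rw [h.lie_even_str, add_zero, h.even_mul_str, ← mul_add, h.str_mul_even]
  ring_nf

lemma lie_odd_strSum_even_even (m : ℤ) :
    ⁅∑ s ∈ Finset.range n, e (2 * s + 1), h.strSum 0 (2 * m)⁆ =
      (2 : ℝ) • (h.strSum (-1) (2 * m) - h.strSum 0 (2 * m - 1)) := by
  rw [strSum, strSum, strSum, lie_sum, ← Finset.sum_sub_distrib, Finset.smul_sum]
  refine Finset.sum_congr rfl fun r _ => ?_
  rw [h.lie_odd_str, add_zero, h.odd_mul_str, ← mul_add, h.str_mul_odd]
  ring_nf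

lemma lie_even_strSum_odd_odd (m : ℤ) :
    ⁅∑ s ∈ Finset.range n, e (2 * s), h.strSum 1 (2 * m + 1)⁆ =
      (2 : ℝ) • (h.strSum 0 (2 * m + 1) - h.strSum 1 (2 * m)) := by
  rw [strSum, strSum, strSum, lie_sum, ← Finset.sum_sub_distrib, Finset.smul_sum]
  refine Finset.sum_congr rfl fun r _ => ?_
  rw [h.lie_even_str, h.even_mul_str', ← add_assoc, ← mul_add, h.str_mul_even']
  ring_nf

lemma lie_odd_strSum_odd_odd (m : ℤ) :
    ⁅∑ s ∈ Finset.range n, e (2 * s + 1), h.strSum 1 (2 * m + 1)⁆ =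
      (2 : ℝ) • (h.strSum 2 (2 * m + 1) - h.strSum 1 (2 * m + 2)) := by
  rw [strSum, strSum, strSum, lie_sum, ← Finset.sum_sub_distrib, Finset.smul_sum]
  refine Finset.sum_congr rfl fun r _ => ?_
  rw [h.lie_odd_str, h.odd_mul_str', ← add_assoc, ← mul_add, h.str_mul_odd']
  ring_nf

omit [Algebra ℝ R] h in
lemma lie_I_smul_I_smul [Algebra ℂ R] (x y : R) : ⁅Complex.I • x, Complex.I • y⁆ = -⁅x, y⁆ := by
  simp only [Ring.lie_def, smul_mul_smul_comm, Complex.I_mul_I, neg_smul, one_smul]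
  abel

omit [Algebra ℝ R] h in
lemma lie_I_smul [Algebra ℂ R] (x y : R) : ⁅Complex.I • x, y⁆ = Complex.I • ⁅x, y⁆ := by
  simp only [Ring.lie_def, smul_mul_assoc, mul_smul_comm, smul_sub]

lemma strSum_one_zero : h.strSum 1 0 = ∑ s ∈ Finset.range n, e (2 * s) :=
  Finset.sum_congr rfl fun r _ => by rw [add_zero, str_add_one']

lemma strSum_zero_one : h.strSum 0 1 = ∑ s ∈ Finset.range n, e (2 * s) :=
  Finset.sum_congr rfl fun r _ => by rw [add_zero, str_add_one]

lemma strSum_one_two : h.strSum 1 2 = ∑ s ∈ Finset.range n, e (2 * s + 1) :=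
  Finset.sum_congr rfl fun r _ => by
    rw [show 2 * (r : ℤ) + 2 = 2 * r + 1 + 1 by ring, str_add_one]

lemma strSum_two_one : h.strSum 2 1 = ∑ s ∈ Finset.range n, e (2 * s + 1) :=
  Finset.sum_congr rfl fun r _ => by
    rw [show 2 * (r : ℤ) + 2 = 2 * r + 1 + 1 by ring, str_add_one']

variable [Algebra ℂ R] [IsScalarTower ℝ ℂ R]

/-- Translating by an even number of bonds brings every bracket to normal form. `A'` is needed
because the brackets with `G` produce strings from even to odd bonds, that is, reversed strings. -/
theorem onsagerSeed : OnsagerSeed (fun m => Complex.I • h.strSum 1 (2 * m))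
    (fun m => Complex.I • h.strSum (2 * m) 1)
    (fun m => h.strSum 0 (2 * m) - h.strSum 1 (2 * m + 1)) where
  lie_zero_A m := by
    rw [mul_zero, strSum_one_zero, lie_I_smul_I_smul, lie_even_strSum_odd_even]
    module
  lie_one_A m := by
    have h1 := h.strSum_shift 1 0 (2 * (m - 1))
    rw [show 0 + 2 * (1 : ℤ) = 2 by ring, show 2 * (m - 1) + 2 * 1 = 2 * m by ring] at h1
    rw [mul_one, strSum_one_two, lie_I_smul_I_smul, lie_odd_strSum_odd_even, h1,
      show 2 * (m - 1) + 1 = 2 * m - 1 by ring]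
    module
  lie_zero_A' m := by
    have h1 := h.strSum_shift m 0 (2 * (-m))
    rw [show 0 + 2 * m = 2 * m by ring, show 2 * (-m) + 2 * m = 0 by ring] at h1
    have h2 := h.strSum_shift m 1 (2 * (-m) + 1)
    rw [show 1 + 2 * m = 2 * m + 1 by ring, show 2 * (-m) + 1 + 2 * m = 1 by ring] at h2
    rw [mul_zero, strSum_one_zero, lie_I_smul_I_smul, lie_even_strSum_even_odd, h1, h2]
    module
  lie_one_A' m := by
    have h1 := h.strSum_shift m 0 (2 * (1 - m))
    rw [show 0 + 2 * m = 2 * m by ring, show 2 * (1 - m) + 2 * m = 2 by ring] at h1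
    have h2 := h.strSum_shift (m - 1) 1 (2 * (1 - m) + 1)
    rw [show 1 + 2 * (m - 1) = 2 * m - 1 by ring,
      show 2 * (1 - m) + 1 + 2 * (m - 1) = 1 by ring] at h2
    rw [mul_one, strSum_one_two, lie_I_smul_I_smul, lie_odd_strSum_even_odd, h1, h2]
    module
  lie_zero_G m := by
    have h1 := h.strSum_shift (-m) 0 (2 * m + 1)
    rw [show 0 + 2 * -m = 2 * -m by ring, show 2 * m + 1 + 2 * -m = 1 by ring] at h1
    rw [mul_zero, strSum_one_zero, lie_I_smul, lie_sub, lie_even_strSum_even_even,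
      lie_even_strSum_odd_odd, h1]
    module
  lie_one_G m := by
    have h1 := h.strSum_shift (-m) 0 (2 * m - 1)
    rw [show 0 + 2 * -m = 2 * -m by ring, show 2 * m - 1 + 2 * -m = -1 by ring] at h1
    have h2 := h.strSum_shift 1 (2 * -m) (-1)
    rw [show 2 * -m + 2 * 1 = 2 * (1 - m) by ring, show -1 + 2 * (1 : ℤ) = 1 by ring] at h2
    have h3 := h.strSum_shift (-m) 2 (2 * m + 1)
    rw [show 2 + 2 * -m = 2 * (1 - m) by ring, show 2 * m + 1 + 2 * -m = 1 by ring] at h3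
    have h4 := h.strSum_shift 1 (-1) (2 * m)
    rw [show -1 + 2 * (1 : ℤ) = 1 by ring, show 2 * m + 2 * 1 = 2 * (m + 1) by ring] at h4
    rw [mul_one, strSum_one_two, lie_I_smul, lie_sub, lie_odd_strSum_even_even,
      lie_odd_strSum_odd_odd, ← h1, ← h2, ← h3, ← h4, show 2 * m + 2 = 2 * (m + 1) by ring]
    module
  zero := by rw [mul_zero, strSum_one_zero, strSum_zero_one]
  one := by rw [mul_one, strSum_one_two, strSum_two_one]

end BondAlgebra

end Strings

end IsingChain

namespace IsingChain

open Matrix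

/-! ### Tensor products and permutations of their factors. -/

section Tensor

variable {n : ℕ}

lemma tensor_mul (M N : Fin n → Matrix (Fin 2) (Fin 2) ℂ) :
    tensor M * tensor N = tensor fun i => M i * N i := by
  ext p q
  simp only [tensor, mul_apply, of_apply, ← Finset.prod_mul_distrib]
  rw [Finset.prod_univ_sum, Fintype.piFinset_univ]

lemma tensor_one : tensor (fun _ : Fin n => (1 : Matrix (Fin 2) (Fin 2) ℂ)) = 1 := by
  ext p q
  simp only [tensor, of_apply, one_apply]
  by_cases h : p = q
  · simp [h]
  · obtain ⟨i, hi⟩ := Function.ne_iff.1 h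
    rw [if_neg h]
    exact Finset.prod_eq_zero (Finset.mem_univ i) (if_neg hi)

lemma trace_tensor (M : Fin n → Matrix (Fin 2) (Fin 2) ℂ) :
    trace (tensor M) = ∏ i, trace (M i) := by
  simp only [tensor, trace, diag_apply, of_apply]
  rw [Finset.prod_univ_sum, Fintype.piFinset_univ]

lemma conjTranspose_tensor (M : Fin n → Matrix (Fin 2) (Fin 2) ℂ) :
    (tensor M)ᴴ = tensor fun i => (M i)ᴴ := by
  ext p q
  simp [tensor, conjTranspose_apply]

lemma tensor_smul_at {M N : Fin n → Matrix (Fin 2) (Fin 2) ℂ} (j : Fin n) (c : ℂ)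
    (hj : M j = c • N j) (h : ∀ i, i ≠ j → M i = N i) : tensor M = c • tensor N := by
  ext p q
  rw [Matrix.smul_apply, smul_eq_mul]
  simp only [tensor, of_apply]
  rw [← Finset.mul_prod_erase _ _ (Finset.mem_univ j),
    ← Finset.mul_prod_erase _ (fun i => N i (p i) (q i)) (Finset.mem_univ j), hj,
    Matrix.smul_apply, smul_eq_mul, mul_assoc]
  congr 2
  exact Finset.prod_congr rfl fun i hi => by rw [h i (Finset.ne_of_mem_erase hi)]

lemma permOp_conj_tensor (s : Equiv.Perm (Fin n)) (M : Fin n → Matrix (Fin 2) (Fin 2) ℂ) :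
    permOp s * tensor M * (permOp s)ᵀ = tensor fun i => M (s i) := by
  ext p q
  rw [permOp, Matrix.transpose_permMatrix, Equiv.Perm.permMatrix, Equiv.Perm.permMatrix,
    PEquiv.toMatrix_toPEquiv_mul, PEquiv.mul_toMatrix_toPEquiv]
  simp only [tensor, submatrix_apply, of_apply]
  rw [← Equiv.prod_comp s]
  refine Finset.prod_congr rfl fun i _ => ?_
  rw [show ((Equiv.arrowCongr s (Equiv.refl (Fin 2)) : Equiv.Perm (Fin n → Fin 2))⁻¹).symm =
    Equiv.arrowCongr s (Equiv.refl (Fin 2)) from rfl]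
  simp [Equiv.arrowCongr]

lemma permOp_transpose_mul (s : Equiv.Perm (Fin n)) : (permOp s)ᵀ * permOp s = 1 := by
  rw [permOp, Matrix.transpose_permMatrix, ← Matrix.permMatrix_mul, mul_inv_cancel,
    Matrix.permMatrix_one]

end Tensor

end IsingChain

namespace IsingChain

open Matrix

/-! ### Pauli matrices and the brackets of `H0`, `H1` with site operators. -/

section Pauli

lemma sigmaX_sq : sigmaX * sigmaX = 1 := by
  ext i j; fin_cases i <;> fin_cases j <;> simp [sigmaX]

lemma sigmaZ_sq : sigmaZ * sigmaZ = 1 := by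
  ext i j; fin_cases i <;> fin_cases j <;> simp [sigmaZ]

lemma sigmaZ_mul_sigmaX : sigmaZ * sigmaX = -(sigmaX * sigmaZ) := by
  ext i j; fin_cases i <;> fin_cases j <;> simp [sigmaX, sigmaZ]

lemma sigmaZ_mul_sigmaX_mul_sigmaZ : sigmaZ * (sigmaX * sigmaZ) = (-1 : ℂ) • sigmaX := by
  ext i j; fin_cases i <;> fin_cases j <;> simp [sigmaX, sigmaZ]

lemma sigmaY_eq : sigmaY = Complex.I • (sigmaZ * sigmaX) := by
  ext i j; fin_cases i <;> fin_cases j <;> simp [sigmaX, sigmaZ, sigmaY]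

/-- With `sigmaY_eq`, this lets `σ_x` be split off on the left or on the right, so that a `σ_y` at
either end of a block is a `σ_z` prolonged by the bond `σ_x`. -/
lemma sigmaY_eq' : sigmaY = (-Complex.I) • (sigmaX * sigmaZ) := by
  ext i j; fin_cases i <;> fin_cases j <;> simp [sigmaX, sigmaZ, sigmaY]

lemma conjTranspose_sigmaX : sigmaXᴴ = sigmaX := by
  ext i j; fin_cases i <;> fin_cases j <;> simp [sigmaX]

lemma conjTranspose_sigmaZ : sigmaZᴴ = sigmaZ := by
  ext i j; fin_cases i <;> fin_cases j <;> simp [sigmaZ]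

end Pauli

section Site

variable {n : ℕ}

lemma site_mul_same (σ τ : Matrix (Fin 2) (Fin 2) ℂ) (j : Fin n) :
    site σ j * site τ j = site (σ * τ) j := by
  rw [site, site, tensor_mul, site]
  congr 1; funext i; split_ifs <;> simp

lemma site_one (j : Fin n) : site (1 : Matrix (Fin 2) (Fin 2) ℂ) j = 1 := by
  rw [← tensor_one, site]; congr 1; funext i; simp

lemma site_neg (σ : Matrix (Fin 2) (Fin 2) ℂ) (j : Fin n) : site (-σ) j = -site σ j := by
  rw [← neg_one_smul ℂ (site σ j)]
  exact tensor_smul_at j _ (by simp) (fun i hi => by simp [hi])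

lemma site_comm (σ τ : Matrix (Fin 2) (Fin 2) ℂ) {i j : Fin n} (h : i ≠ j) :
    site σ i * site τ j = site τ j * site σ i := by
  rw [site, site, tensor_mul, tensor_mul]
  congr 1; funext k
  by_cases hi : k = i
  · subst hi; simp [h]
  · simp [hi]

lemma conjTranspose_site {σ : Matrix (Fin 2) (Fin 2) ℂ} (hσ : σᴴ = σ) (j : Fin n) :
    (site σ j)ᴴ = site σ j := by
  rw [site, conjTranspose_tensor]
  congr 1; funext i; split_ifs <;> simp [hσ]

lemma siteZ_mul_siteX (j : Fin n) :
    site sigmaZ j * site sigmaX j = -(site sigmaX j * site sigmaZ j) := by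
  rw [site_mul_same, site_mul_same, sigmaZ_mul_sigmaX, site_neg]

lemma lie_siteX_siteZ (i j : Fin n) : ⁅site sigmaX i, site sigmaZ j⁆ =
    if i = j then (2 : ℝ) • (site sigmaX j * site sigmaZ j) else 0 := by
  split_ifs with h
  · subst h
    rw [Ring.lie_def, siteZ_mul_siteX]; module
  · rw [Ring.lie_def, site_comm _ _ h, sub_self]

lemma lie_sites_self (σ : Matrix (Fin 2) (Fin 2) ℂ) (i j : Fin n) :
    ⁅site σ i, site σ j⁆ = 0 := by
  rcases eq_or_ne i j with rfl | h
  · rw [lie_self]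
  · rw [Ring.lie_def, site_comm _ _ h, sub_self]

lemma site_mul_comm (σ : Matrix (Fin 2) (Fin 2) ℂ) (i j : Fin n) :
    site σ i * site σ j = site σ j * site σ i :=
  sub_eq_zero.1 (lie_sites_self σ i j)

variable {R : Type*} [Ring R]

lemma lie_mul_eq (a b c : R) : ⁅a, b * c⁆ = ⁅a, b⁆ * c + b * ⁅a, c⁆ := by
  simp only [Ring.lie_def]; noncomm_ring

lemma mul_lie_eq (a b c : R) : ⁅a * b, c⁆ = a * ⁅b, c⁆ + ⁅a, c⁆ * b := by
  simp only [Ring.lie_def]; noncomm_ring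

lemma lie_H1_siteZ (j : Fin n) :
    ⁅H1 n, site sigmaZ j⁆ = (2 : ℝ) • (site sigmaX j * site sigmaZ j) := by
  rw [H1, sum_lie]
  simp [lie_siteX_siteZ]

lemma lie_H1_siteX (j : Fin n) : ⁅H1 n, site sigmaX j⁆ = 0 := by
  rw [H1, sum_lie]
  exact Finset.sum_eq_zero fun i _ => lie_sites_self _ _ _

lemma lie_H1_siteZZ (i j : Fin n) : ⁅H1 n, site sigmaZ i * site sigmaZ j⁆ =
    (2 : ℝ) • (site sigmaX i * (site sigmaZ i * site sigmaZ j) -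
      site sigmaZ i * site sigmaZ j * site sigmaX j) := by
  rw [lie_mul_eq, lie_H1_siteZ, lie_H1_siteZ, mul_assoc _ _ (site sigmaX j), siteZ_mul_siteX,
    smul_mul_assoc, mul_smul_comm, mul_neg, mul_assoc]
  module

/-- Only the two bonds meeting at the site contribute. The site is written `finRotate n j` so that
the bond on its left has index `j`. -/
lemma lie_H0_siteX (j : Fin n) : ⁅H0 n, site sigmaX (finRotate n j)⁆ =
    (2 : ℝ) • (site sigmaZ j * site sigmaZ (finRotate n j) * site sigmaX (finRotate n j) -
      site sigmaX (finRotate n j) *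
        (site sigmaZ (finRotate n j) * site sigmaZ (finRotate n (finRotate n j)))) := by
  have e1 : ∀ i j : Fin n, ⁅site sigmaZ i, site sigmaX j⁆ =
      if i = j then (-2 : ℝ) • (site sigmaX j * site sigmaZ j) else 0 := by
    intro i j
    rw [← lie_skew, lie_siteX_siteZ]
    by_cases h : j = i
    · subst h; simp
    · rw [if_neg h, if_neg (Ne.symm h), neg_zero]
  rw [H0, sum_lie]
  simp only [mul_lie_eq, Finset.sum_add_distrib, e1, (finRotate n).injective.eq_iff]
  simp only [mul_ite, ite_mul, mul_zero, zero_mul, Finset.sum_ite_eq', Finset.mem_univ, if_true]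
  rw [mul_assoc _ _ (site sigmaX (finRotate n j)), siteZ_mul_siteX, mul_neg, mul_smul_comm,
    smul_mul_assoc, mul_assoc (site sigmaX _)]
  module

lemma lie_H0_siteZ (j : Fin n) : ⁅H0 n, site sigmaZ j⁆ = 0 := by
  rw [H0, sum_lie]
  refine Finset.sum_eq_zero fun i _ => ?_
  rw [mul_lie_eq, lie_sites_self, lie_sites_self, mul_zero, zero_mul, add_zero]

end Site

/-! ### The bonds of the chain and their cyclic symmetrization. -/

section Bond

variable (n : ℕ) [NeZero n]

/-- The site `r` modulo `n`. -/
def siteIdx (r : ℤ) : Fin n :=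
  ⟨(r % n).toNat, by
    have := NeZero.pos n
    have := Int.emod_lt_of_pos r (by omega : (0 : ℤ) < n)
    have := Int.emod_nonneg r (by omega : (n : ℤ) ≠ 0)
    omega⟩

lemma siteIdx_natCast (i : Fin n) : siteIdx n (i : ℕ) = i := by
  ext
  simp only [siteIdx]
  rw [Int.emod_eq_of_lt (by omega) (by omega)]
  simp

lemma siteIdx_natCast_val {k : ℕ} (hk : k < n) : (siteIdx n k : ℕ) = k :=
  congrArg Fin.val (siteIdx_natCast n ⟨k, hk⟩)

lemma siteIdx_add_mul (r s : ℤ) : siteIdx n (r + n * s) = siteIdx n r := by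
  simp [siteIdx]

lemma finRotate_siteIdx (r : ℤ) : finRotate n (siteIdx n r) = siteIdx n (r + 1) := by
  obtain ⟨k, rfl⟩ : ∃ k, n = k + 1 := ⟨n - 1, by have := NeZero.pos n; omega⟩
  ext
  have h1 := Int.emod_nonneg r (by omega : ((k + 1 : ℕ) : ℤ) ≠ 0)
  have h2 := Int.emod_lt_of_pos r (by omega : (0 : ℤ) < (k + 1 : ℕ))
  rw [coe_finRotate]
  simp only [siteIdx, Fin.ext_iff, Fin.val_last]
  rw [← Int.emod_add_emod]
  split_ifs with h
  · rw [show r % ((k + 1 : ℕ) : ℤ) + 1 = (k + 1 : ℕ) by omega]; simp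
  · rw [Int.emod_eq_of_lt (a := r % ((k + 1 : ℕ) : ℤ) + 1) (by omega) (by omega)]; omega

lemma finRotate_pow_siteIdx (k : ℕ) (r : ℤ) :
    (finRotate n ^ k) (siteIdx n r) = siteIdx n (r + k) := by
  induction k with
  | zero => simp
  | succ k ih => rw [pow_succ', Equiv.Perm.mul_apply, ih, finRotate_siteIdx]; push_cast; ring_nf

/-- The involutions `σ_x^r` (index `2 r`) and `σ_z^r σ_z^{r+1}` (index `2 r + 1`). -/
noncomputable def bond (k : ℤ) : ChainMat n :=
  if k % 2 = 0 then site sigmaX (siteIdx n (k / 2))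
  else site sigmaZ (siteIdx n (k / 2)) * site sigmaZ (siteIdx n (k / 2 + 1))

lemma bond_even (r : ℤ) : bond n (2 * r) = site sigmaX (siteIdx n r) := by
  rw [bond, if_pos (by omega), show 2 * r / 2 = r by omega]

lemma bond_odd (r : ℤ) : bond n (2 * r + 1) =
    site sigmaZ (siteIdx n r) * site sigmaZ (siteIdx n (r + 1)) := by
  rw [bond, if_neg (by omega), show (2 * r + 1) / 2 = r by omega]

lemma sum_bond_even : ∑ s ∈ Finset.range n, bond n (2 * s) = H1 n := by
  rw [Finset.sum_range (fun s : ℕ => bond n (2 * s)), H1]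
  exact Finset.sum_congr rfl fun i _ => by rw [bond_even, siteIdx_natCast]

lemma sum_bond_odd : ∑ s ∈ Finset.range n, bond n (2 * s + 1) = H0 n := by
  rw [Finset.sum_range (fun s : ℕ => bond n (2 * s + 1)), H0]
  exact Finset.sum_congr rfl fun i _ => by rw [bond_odd, ← finRotate_siteIdx, siteIdx_natCast]

theorem bondAlgebra : BondAlgebra n (bond n) where
  mul_self k := by
    rcases Int.even_or_odd' k with ⟨r, rfl | rfl⟩
    · rw [bond_even, site_mul_same, sigmaX_sq, site_one]
    · rw [bond_odd]
      nth_rw 1 [site_mul_comm]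
      rw [mul_assoc, ← mul_assoc (site sigmaZ (siteIdx n r)), site_mul_same, sigmaZ_sq, site_one,
        one_mul, site_mul_same, sigmaZ_sq, site_one]
  periodic k := by
    have hr : ∀ r, siteIdx n (r + n) = siteIdx n r := fun r => by
      simpa using siteIdx_add_mul n r 1
    rcases Int.even_or_odd' k with ⟨r, rfl | rfl⟩
    · rw [← mul_add, bond_even, bond_even, hr]
    · rw [show 2 * r + 1 + 2 * (n : ℤ) = 2 * (r + n) + 1 by ring, bond_odd, bond_odd, hr,
        add_right_comm, hr]
  even_even r := by rw [sum_bond_even, bond_even, lie_H1_siteX]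
  even_odd r := by
    rw [sum_bond_even, show 2 * r + 2 = 2 * (r + 1) by ring, bond_even, bond_even, bond_odd,
      lie_H1_siteZZ]
  odd_odd r := by
    rw [sum_bond_odd, bond_odd, lie_mul_eq, lie_H0_siteZ, lie_H0_siteZ, mul_zero, zero_mul,
      add_zero]
  odd_even r := by
    have := lie_H0_siteX (siteIdx n (r - 1))
    rw [finRotate_siteIdx, finRotate_siteIdx, sub_add_cancel] at this
    rw [sum_bond_odd, show 2 * r - 1 = 2 * (r - 1) + 1 by ring, bond_even, bond_odd, bond_odd,
      sub_add_cancel, this]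

/-- Conjugation by the `k`-th power of the cyclic shift. -/
noncomputable def shiftConj (k : ℕ) : ChainMat n →* ChainMat n where
  toFun A := permOp (finRotate n ^ k) * A * (permOp (finRotate n ^ k))ᵀ
  map_one' := by
    rw [mul_one, mul_eq_one_comm, permOp_transpose_mul]
  map_mul' A B := by
    rw [mul_assoc (permOp _ * A), ← mul_assoc _ (permOp _ * B), ← mul_assoc _ (permOp _) B,
      permOp_transpose_mul, one_mul, mul_assoc, mul_assoc, mul_assoc]

omit [NeZero n] in
lemma symmetrize_eq (A : ChainMat n) :
    symmetrize A = ∑ k ∈ Finset.range n, shiftConj n k A := rfl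

omit [NeZero n] in
lemma shiftConj_smul (k : ℕ) (c : ℂ) (A : ChainMat n) :
    shiftConj n k (c • A) = c • shiftConj n k A := by
  simp [shiftConj]

omit [NeZero n] in
lemma symmetrize_smul (c : ℂ) (A : ChainMat n) : symmetrize (c • A) = c • symmetrize A := by
  simp only [symmetrize_eq, shiftConj_smul, Finset.smul_sum]

omit [NeZero n] in
lemma shiftConj_tensor (k : ℕ) (M : Fin n → Matrix (Fin 2) (Fin 2) ℂ) :
    shiftConj n k (tensor M) = tensor fun i => M ((finRotate n ^ k) i) :=
  permOp_conj_tensor _ _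

lemma shiftConj_site (k : ℕ) (σ : Matrix (Fin 2) (Fin 2) ℂ) (r : ℤ) :
    shiftConj n k (site σ (siteIdx n r)) = site σ (siteIdx n (r + -k)) := by
  rw [site, shiftConj_tensor, site]
  congr 1; funext i
  have : siteIdx n r = (finRotate n ^ k) (siteIdx n (r + -k)) := by
    rw [finRotate_pow_siteIdx]; ring_nf
  simp only [this, (finRotate n ^ k).injective.eq_iff]

lemma shiftConj_bond (k : ℕ) (j : ℤ) : shiftConj n k (bond n j) = bond n (j + 2 * -k) := by
  rcases Int.even_or_odd' j with ⟨r, rfl | rfl⟩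
  · rw [bond_even, shiftConj_site, ← mul_add, bond_even]
  · rw [bond_odd, map_mul, shiftConj_site, shiftConj_site,
      show 2 * r + 1 + 2 * (-k : ℤ) = 2 * (r + -k) + 1 by ring, bond_odd, add_right_comm]

/-- The strings of bonds. -/
noncomputable abbrev bstr (j k : ℤ) : ChainMat n := str (bond n) (bondAlgebra n).mul_self j k

lemma shiftConj_bstr (k : ℕ) (i j : ℤ) :
    shiftConj n k (bstr n i j) = bstr n (i + 2 * -k) (j + 2 * -k) :=
  map_str _ _ _ (shiftConj_bond n k) i j

lemma symmetrize_bstr (i j : ℤ) : symmetrize (bstr n i j) = (bondAlgebra n).strSum i j := by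
  -- Conjugation by the `k`-th power translates by `-k` sites, hence the reversal of the summation
  -- index.
  rw [symmetrize_eq, BondAlgebra.strSum,
    ← sum_range_neg (f := fun r : ℤ => bstr n (2 * r + i) (2 * r + j)) (fun r => by
      have := (bondAlgebra n).str_periodic (2 * r + i) (2 * r + j)
      rw [bstr, bstr, ← this]; ring_nf)]
  exact Finset.sum_congr rfl fun k _ => by rw [shiftConj_bstr, add_comm i, add_comm j]

end Bond

end IsingChain

namespace IsingChain

open Matrix

/-! ### The generators of the statement as sums of strings. -/

section Block

variable {n : ℕ} [NeZero n]

lemma eq_siteIdx_iff {k : ℕ} (hk : k < n) (i : Fin n) : i = siteIdx n k ↔ (i : ℕ) = k := by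
  rw [Fin.ext_iff, siteIdx_natCast_val n hk]

lemma block_mul_site {k : ℕ} (hk : k + 1 < n) (A B C : Matrix (Fin 2) (Fin 2) ℂ) :
    block n A B k * site C (siteIdx n (k + 1 : ℕ)) = block n A (B * C) k := by
  rw [block, site, tensor_mul, block]
  congr 1; funext i
  simp only [eq_siteIdx_iff hk]
  split_ifs <;> first | omega | simp

lemma site_mul_block {k : ℕ} (A B C : Matrix (Fin 2) (Fin 2) ℂ) :
    site C (siteIdx n 0) * block n A B k = block n (C * A) B k := by
  rw [block, site, tensor_mul, block]
  congr 1; funext i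
  have := eq_siteIdx_iff (NeZero.pos n) i
  rw [Nat.cast_zero] at this
  simp only [this]
  split_ifs <;> first | omega | simp

lemma block_mul_site_zero {k : ℕ} (A B C : Matrix (Fin 2) (Fin 2) ℂ) :
    block n A B k * site C (siteIdx n 0) = block n (A * C) B k := by
  rw [block, site, tensor_mul, block]
  congr 1; funext i
  have := eq_siteIdx_iff (NeZero.pos n) i
  rw [Nat.cast_zero] at this
  simp only [this]
  split_ifs <;> first | omega | simp

lemma block_sigmaX_mul_site {k : ℕ} (hk : k + 2 < n) (A B : Matrix (Fin 2) (Fin 2) ℂ) :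
    block n A sigmaX k * site B (siteIdx n (k + 2 : ℕ)) = block n A B (k + 1) := by
  rw [block, site, tensor_mul, block]
  congr 1; funext i
  simp only [eq_siteIdx_iff hk]
  split_ifs <;> first | omega | simp

lemma block_smul_left {k : ℕ} (c : ℂ) (A B : Matrix (Fin 2) (Fin 2) ℂ) :
    block n (c • A) B k = c • block n A B k := by
  have h0 := siteIdx_natCast_val n (NeZero.pos n)
  refine tensor_smul_at (siteIdx n (0 : ℕ)) c (by simp only [h0]; simp) fun i hi => ?_
  rw [Ne, eq_siteIdx_iff (NeZero.pos n)] at hi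
  simp [hi]

lemma block_smul_right {k : ℕ} (hk : k + 1 < n) (c : ℂ) (A B : Matrix (Fin 2) (Fin 2) ℂ) :
    block n A (c • B) k = c • block n A B k := by
  have h0 := siteIdx_natCast_val n hk
  refine tensor_smul_at (siteIdx n (k + 1 : ℕ)) c (by simp only [h0]; simp) fun i hi => ?_
  rw [Ne, eq_siteIdx_iff hk] at hi
  simp [hi]

/-- The inner site carries `σ_z σ_x σ_z = -σ_x`, the source of all the alternating signs. The last
`σ_z` stays a separate factor because for `k + 2 = n` it falls on site 0. -/
lemma bstr_one_add_two {k : ℕ} (hk : k + 1 < n) (c : ℂ)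
    (h : bstr n 1 (2 * (k + 1)) = c • block n sigmaZ sigmaZ k) :
    bstr n 1 (2 * (k + 2)) =
      -c • (block n sigmaZ sigmaX k * site sigmaZ (siteIdx n (k + 2))) := by
  rw [bstr, show 2 * ((k : ℤ) + 2) = 2 * (k + 1) + 1 + 1 by ring, str_succ, str_succ, ← bstr, h,
    bond_even, bond_odd, smul_mul_assoc, smul_mul_assoc]
  have e := block_mul_site hk
  push_cast at e
  rw [← mul_assoc, e, e, mul_assoc sigmaZ, sigmaZ_mul_sigmaX_mul_sigmaZ, block_smul_right hk,
    smul_mul_assoc, show (k : ℤ) + 1 + 1 = k + 2 by ring]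
  module

lemma bstr_one_eq_block {k : ℕ} (hk : k + 1 < n) :
    bstr n 1 (2 * (k + 1)) = (-1 : ℂ) ^ k • block n sigmaZ sigmaZ k := by
  induction k with
  | zero =>
    rw [bstr, Nat.cast_zero, show 2 * ((0 : ℤ) + 1) = 1 + 1 by ring, str_add_one,
      show (1 : ℤ) = 2 * 0 + 1 by ring, bond_odd, pow_zero, one_smul]
    have e := block_mul_site hk sigmaZ 1 sigmaZ
    rw [one_mul] at e
    rw [← e, zero_add, zero_add, ← Nat.cast_one (R := ℤ)]
    congr 1
    rw [site, block]
    congr 1; funext i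
    have := eq_siteIdx_iff (NeZero.pos n) i
    rw [Nat.cast_zero] at this
    simp only [this]
    split_ifs <;> first | omega | simp
  | succ k ih =>
    have e := block_sigmaX_mul_site hk sigmaZ sigmaZ
    push_cast at e
    rw [Nat.cast_succ, show 2 * ((k : ℤ) + 1 + 1) = 2 * (k + 2) by ring,
      bstr_one_add_two (by omega) _ (ih (by omega)), e, pow_succ, mul_neg_one]

/-- At the closing step the final `σ_z` meets the initial one at site 0 and `σ_z² = 1`. What remains
is `σ_x` at every site but 0. -/
lemma bstr_full (hn : 2 ≤ n) :
    bstr n 1 (2 * n) = (-1 : ℂ) ^ (n - 1) • block n 1 sigmaX (n - 2) := by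
  obtain ⟨k, hk⟩ : ∃ k, n = k + 2 := ⟨n - 2, by omega⟩
  have e := bstr_one_add_two (by omega) _ (bstr_one_eq_block (n := n) (k := k) (by omega))
  have h0 : siteIdx n ((k : ℤ) + 2) = siteIdx n 0 := by
    have := siteIdx_add_mul n 0 1
    rw [← this]; congr 1; omega
  rw [h0, block_mul_site_zero, sigmaZ_sq] at e
  have h1 : (n : ℤ) = k + 2 := by omega
  rw [h1, e, show n - 1 = k + 1 by omega, show n - 2 = k by omega, pow_succ, mul_neg_one]

/-- The full string lacks only `σ_x` at site 0. Supplying it on the left or on the right gives the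
same flip operator, since the string is the identity there. -/
lemma strSum_full_eq (hn : 2 ≤ n) :
    (bondAlgebra n).strSum 0 (2 * n) = (bondAlgebra n).strSum 1 (2 * n + 1) := by
  have h0 : bond n 0 = site sigmaX (siteIdx n 0) := bond_even n 0
  have h1 : bond n (2 * n) = site sigmaX (siteIdx n 0) := by
    rw [← h0, ← (bondAlgebra n).periodic 0, zero_add]
  rw [← symmetrize_bstr, ← symmetrize_bstr]
  congr 1
  rw [bstr, bstr, show (0 : ℤ) = 1 - 1 by ring, pred_str, str_succ, h1, sub_self, h0]
  have := bstr_full hn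
  rw [bstr] at this
  rw [this, mul_smul_comm, smul_mul_assoc, site_mul_block, block_mul_site_zero, mul_one, one_mul]

lemma finRotate_val (i : Fin n) :
    (finRotate n i : ℕ) = if (i : ℕ) + 1 = n then 0 else (i : ℕ) + 1 := by
  obtain ⟨k, rfl⟩ : ∃ k, n = k + 1 := ⟨n - 1, by have := NeZero.pos n; omega⟩
  rw [coe_finRotate]
  simp [Fin.ext_iff]

lemma neg_one_pow_smul {V : Type*} [AddCommGroup V] [Module ℝ V] [Module ℂ V] (k : ℕ) (v : V) :
    (-1 : ℂ) ^ k • v = (-1 : ℝ) ^ k • v := by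
  rcases Nat.even_or_odd k with h | h <;> simp [h.neg_one_pow]

/-- The Onsager generators of the chain: `𝐙^j`, `𝐗`, `𝐗𝐗` and `𝐘^j` up to sign. -/
noncomputable def genA (n : ℕ) [NeZero n] (m : ℤ) : ChainMat n :=
  Complex.I • (bondAlgebra n).strSum 1 (2 * m)

/-- The Onsager generators of the chain: `𝐘𝐙^j` up to sign. -/
noncomputable def genG (n : ℕ) [NeZero n] (m : ℤ) : ChainMat n :=
  (bondAlgebra n).strSum 0 (2 * m) - (bondAlgebra n).strSum 1 (2 * m + 1)

theorem genA_seed : OnsagerSeed (genA n)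
    (fun m => Complex.I • (bondAlgebra n).strSum (2 * m) 1) (genG n) :=
  (bondAlgebra n).onsagerSeed

lemma genG_card (hn : 2 ≤ n) : genG n n = 0 :=
  sub_eq_zero.2 (strSum_full_eq hn)

lemma genA_zero : genA n 0 = Complex.I • H1 n := by
  rw [genA, mul_zero, BondAlgebra.strSum_one_zero, sum_bond_even]

lemma genA_one : genA n 1 = Complex.I • H0 n := by
  rw [genA, mul_one, BondAlgebra.strSum_one_two, sum_bond_odd]

lemma bX_eq : bX n = genA n 0 := by
  rw [genA, mul_zero, BondAlgebra.strSum_one_zero, ← (bondAlgebra n).strSum_zero_one,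
    ← symmetrize_bstr, bX]
  have h0 : bond n 0 = site sigmaX (siteIdx n 0) := bond_even n 0
  have h1 : bstr n 0 1 = bond n 0 := by
    have := str_add_one (bondAlgebra n).mul_self 0
    rwa [zero_add] at this
  rw [h1, h0, site]
  have := eq_siteIdx_iff (NeZero.pos n)
  rw [Nat.cast_zero] at this
  simp only [this]

lemma bZ_eq {k : ℕ} (hk : k + 1 < n) : bZ n k = (-1 : ℝ) ^ k • genA n (k + 1) := by
  rw [genA, ← symmetrize_bstr, bstr_one_eq_block hk, symmetrize_smul, neg_one_pow_smul, bZ,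
    smul_comm, smul_smul, ← mul_pow]
  norm_num

lemma bXX_eq (hn : 2 ≤ n) : bXX n = (-1 : ℝ) ^ (n - 1) • genA n n := by
  -- The full string leaves site 0 free, `𝐗𝐗` the last site; one cyclic shift turns one into the
  -- other.
  have e : shiftConj n 1 (bstr n 1 (2 * n)) = (-1 : ℂ) ^ (n - 1) •
      tensor fun i : Fin n => if i.val + 1 < n then sigmaX else 1 := by
    rw [bstr_full hn, shiftConj_smul, block, shiftConj_tensor]
    congr 2; funext i
    simp only [pow_one, finRotate_val]
    have := i.isLt
    split_ifs <;> first | omega | rfl | contradiction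
  have h := (bondAlgebra n).strSum_shift (-1) 1 (2 * n)
  rw [shiftConj_bstr] at e
  rw [Nat.cast_one] at e
  rw [genA, ← h, ← symmetrize_bstr, e, symmetrize_smul, neg_one_pow_smul,
    bXX, smul_comm, smul_smul, ← mul_pow]
  norm_num

lemma block_YY {k : ℕ} (hk : k + 1 < n) :
    block n sigmaY sigmaY k = (-1 : ℂ) ^ k • bstr n 0 (2 * (k + 1) + 1) := by
  have h0 : bond n 0 = site sigmaX (siteIdx n 0) := bond_even n 0
  nth_rw 1 [sigmaY_eq']
  rw [sigmaY_eq, block_smul_left, block_smul_right hk, smul_smul, ← block_mul_site hk,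
    ← site_mul_block, mul_assoc, bstr, str_succ, show (0 : ℤ) = 1 - 1 by ring, pred_str, sub_self,
    ← bstr, bstr_one_eq_block hk, bond_even, h0, mul_smul_comm, smul_mul_assoc, smul_smul,
    ← mul_pow, mul_assoc]
  push_cast
  simp

/-- The string of `𝐘^k` runs from an even bond to an odd end, so it belongs to `A'`; the equality of
`A'` and `A` puts it at the negative index. -/
lemma bY_eq {k : ℕ} (hk : k + 1 < n) : bY n k = (-1 : ℝ) ^ k • genA n (-(k + 1)) := by
  have h := (bondAlgebra n).strSum_shift (-(k + 1)) 0 (2 * (k + 1) + 1)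
  rw [show 0 + 2 * -((k : ℤ) + 1) = 2 * -(k + 1) by ring,
    show 2 * ((k : ℤ) + 1) + 1 + 2 * -(k + 1) = 1 by ring] at h
  rw [← genA_seed.A'_eq, h, ← symmetrize_bstr, bY, block_YY hk, symmetrize_smul, neg_one_pow_smul,
    smul_comm]

lemma bYZ_eq {k : ℕ} (hk : k + 1 < n) : bYZ n k = (-1 : ℝ) ^ k • genG n (k + 1) := by
  have h0 : bond n 0 = site sigmaX (siteIdx n 0) := bond_even n 0
  have e1 : block n sigmaZ sigmaY k =
      Complex.I • (-1 : ℂ) ^ k • bstr n 1 (2 * (k + 1) + 1) := by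
    rw [sigmaY_eq, block_smul_right hk, ← block_mul_site hk, bstr, str_succ, ← bstr,
      bstr_one_eq_block hk, bond_even, smul_mul_assoc, smul_smul ((-1) ^ k), ← mul_pow]
    push_cast
    simp
  have e2 : block n sigmaY sigmaZ k = -Complex.I • (-1 : ℂ) ^ k • bstr n 0 (2 * (k + 1)) := by
    rw [sigmaY_eq', block_smul_left, ← site_mul_block, bstr, show (0 : ℤ) = 1 - 1 by ring, pred_str,
      sub_self, ← bstr, bstr_one_eq_block hk, h0, mul_smul_comm, smul_smul ((-1) ^ k), ← mul_pow]
    simp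
  rw [bYZ, e1, e2, genG, symmetrize_smul, symmetrize_smul, symmetrize_smul, symmetrize_smul,
    symmetrize_bstr, symmetrize_bstr, neg_one_pow_smul, neg_one_pow_smul, smul_smul, smul_smul,
    mul_neg, Complex.I_mul_I, neg_neg, one_smul, neg_smul, one_smul]
  module

end Block

end IsingChain

namespace IsingChain

open Matrix

/-! ### Recognizing `su(2)` from a triple of brackets. -/

section Su2

variable {L : Type*} [LieRing L] [LieAlgebra ℝ L]

/-- Bracketing a relation with `u` removes its `u` term; a further bracket with `v` or `w` isolates
one coefficient times `u`, and `u ≠ 0` because `w = ⁅u, v⁆ ≠ 0`. -/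
lemma linearIndependent_of_su2_triple {u v w : L} (h1 : ⁅u, v⁆ = w) (h2 : ⁅v, w⁆ = u)
    (h3 : ⁅w, u⁆ = v) (hw : w ≠ 0) : LinearIndependent ℝ ![u, v, w] := by
  have h1' : ⁅v, u⁆ = -w := by rw [← lie_skew, h1]
  have h2' : ⁅w, v⁆ = -u := by rw [← lie_skew, h2]
  have h3' : ⁅u, w⁆ = -v := by rw [← lie_skew, h3]
  have hu : u ≠ 0 := by rintro rfl; exact hw (by rw [← h1, zero_lie])
  have key : ∀ a b c : ℝ, a • u + b • v + c • w = 0 → b = 0 ∧ c = 0 := by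
    intro a b c h
    have e1 := congrArg (fun t => ⁅u, t⁆) h
    simp only [lie_add, lie_smul, lie_self, h1, h3', lie_zero, smul_zero, zero_add] at e1
    have e2 := congrArg (fun t => ⁅v, t⁆) e1
    have e3 := congrArg (fun t => ⁅w, t⁆) e1
    simp only [lie_add, lie_smul, lie_neg, lie_self, h2, h2', smul_neg, neg_zero, lie_zero,
      smul_zero, add_zero, zero_add, neg_neg] at e2 e3
    exact ⟨(smul_eq_zero.1 e2).resolve_right hu, (smul_eq_zero.1 e3).resolve_right hu⟩
  rw [Fintype.linearIndependent_iff]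
  intro g hg
  simp only [Fin.sum_univ_three, cons_val_zero, cons_val_one, cons_val_two, head_cons, tail_cons]
    at hg
  change g 0 • u + g 1 • v + g 2 • w = 0 at hg
  obtain ⟨hb, hc⟩ := key _ _ _ hg
  have ha : g 0 = 0 := by
    rw [hb, hc, zero_smul, zero_smul, add_zero, add_zero] at hg
    exact (smul_eq_zero.1 hg).resolve_right hu
  intro i
  fin_cases i <;> assumption

lemma nonempty_lieEquiv_of_su2_bases {L' : Type*} [LieRing L'] [LieAlgebra ℝ L']
    (b : Module.Basis (Fin 3) ℝ L) (b' : Module.Basis (Fin 3) ℝ L')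
    (h1 : ⁅b 0, b 1⁆ = b 2) (h2 : ⁅b 1, b 2⁆ = b 0) (h3 : ⁅b 2, b 0⁆ = b 1)
    (h1' : ⁅b' 0, b' 1⁆ = b' 2) (h2' : ⁅b' 1, b' 2⁆ = b' 0) (h3' : ⁅b' 2, b' 0⁆ = b' 1) :
    Nonempty (L ≃ₗ⁅ℝ⁆ L') := by
  have g1 : ⁅b 1, b 0⁆ = -b 2 := by rw [← lie_skew, h1]
  have g2 : ⁅b 2, b 1⁆ = -b 0 := by rw [← lie_skew, h2]
  have g3 : ⁅b 0, b 2⁆ = -b 1 := by rw [← lie_skew, h3]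
  have g1' : ⁅b' 1, b' 0⁆ = -b' 2 := by rw [← lie_skew, h1']
  have g2' : ⁅b' 2, b' 1⁆ = -b' 0 := by rw [← lie_skew, h2']
  have g3' : ⁅b' 0, b' 2⁆ = -b' 1 := by rw [← lie_skew, h3']
  let e : L ≃ₗ[ℝ] L' := b.equiv b' (Equiv.refl _)
  have he : ∀ i, e (b i) = b' i := fun i => by simp [e]
  refine ⟨{ e with map_lie' := ?_ }⟩
  intro x y
  change e ⁅x, y⁆ = ⁅e x, e y⁆
  rw [← b.sum_repr x, ← b.sum_repr y]
  simp only [Fin.sum_univ_three, add_lie, lie_add, smul_lie, lie_smul, lie_self, map_add, map_smul,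
    he, h1, h2, h3, g1, g2, g3, h1', h2', h3', g1', g2', g3', map_neg, map_zero]

/-- The basis `-iσ/2` of `su(2)`. -/
noncomputable def suMat : Fin 3 → Matrix (Fin 2) (Fin 2) ℂ :=
  ![!![0, -Complex.I / 2; -Complex.I / 2, 0], !![0, -1 / 2; 1 / 2, 0],
    !![-Complex.I / 2, 0; 0, Complex.I / 2]]

lemma suMat_mem (i : Fin 3) : suMat i ∈ su 2 := by
  constructor
  · ext j k
    fin_cases i <;> fin_cases j <;> fin_cases k <;> simp [suMat, conjTranspose_apply, neg_div]
  · fin_cases i <;> simp [suMat, trace, Fin.sum_univ_two, neg_div]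

lemma suMat_lie : ⁅suMat 0, suMat 1⁆ = suMat 2 ∧ ⁅suMat 1, suMat 2⁆ = suMat 0 ∧
    ⁅suMat 2, suMat 0⁆ = suMat 1 := by
  refine ⟨?_, ?_, ?_⟩ <;> ext j k <;> fin_cases j <;> fin_cases k <;>
    simp [suMat, Ring.lie_def, Complex.ext_iff] <;> norm_num

lemma suMat_span {A : Matrix (Fin 2) (Fin 2) ℂ} (hA : A ∈ su 2) :
    A = (-2 * (A 1 0).im) • suMat 0 + (2 * (A 1 0).re) • suMat 1 + (-2 * (A 0 0).im) • suMat 2 := by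
  obtain ⟨h1, h2⟩ := hA
  have h00 := congrFun (congrFun h1 0) 0
  have h01 := congrFun (congrFun h1 0) 1
  rw [trace, Fin.sum_univ_two] at h2
  simp [conjTranspose_apply, Complex.ext_iff] at h00 h01 h2
  ext j k
  fin_cases j <;> fin_cases k <;> simp [suMat, Complex.ext_iff] <;> constructor <;> linarith

lemma exists_su2_basis : ∃ b : Module.Basis (Fin 3) ℝ (su 2),
    ⁅b 0, b 1⁆ = b 2 ∧ ⁅b 1, b 2⁆ = b 0 ∧ ⁅b 2, b 0⁆ = b 1 := by
  let t : Fin 3 → su 2 := fun i => ⟨suMat i, suMat_mem i⟩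
  have h1 : ⁅t 0, t 1⁆ = t 2 := Subtype.ext suMat_lie.1
  have h2 : ⁅t 1, t 2⁆ = t 0 := Subtype.ext suMat_lie.2.1
  have h3 : ⁅t 2, t 0⁆ = t 1 := Subtype.ext suMat_lie.2.2
  have hw : t 2 ≠ 0 := fun h => by
    have := congrFun (congrFun (congrArg Subtype.val h) 0) 0
    simp [t, suMat] at this
  have ht : t = ![t 0, t 1, t 2] := by ext i : 1; fin_cases i <;> rfl
  have li : LinearIndependent ℝ t := by
    rw [ht]; exact linearIndependent_of_su2_triple h1 h2 h3 hw
  have sp : ⊤ ≤ Submodule.span ℝ (Set.range t) := by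
    rintro A -
    have : A = (-2 * (A.1 1 0).im) • t 0 + (2 * (A.1 1 0).re) • t 1 + (-2 * (A.1 0 0).im) • t 2 :=
      Subtype.ext (suMat_span A.2)
    rw [this]
    have hm : ∀ i, t i ∈ Submodule.span ℝ (Set.range t) := fun i =>
      Submodule.subset_span ⟨i, rfl⟩
    exact add_mem (add_mem (Submodule.smul_mem _ _ (hm 0)) (Submodule.smul_mem _ _ (hm 1)))
      (Submodule.smul_mem _ _ (hm 2))
  refine ⟨Module.Basis.mk li sp, ?_⟩
  simp only [Module.Basis.mk_apply]
  exact ⟨h1, h2, h3⟩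

/-- A `su(2)` triple spanning a subspace of a Lie subalgebra `K` that `K` normalizes. -/
theorem exists_lieIdeal_su2 (K : LieSubalgebra ℝ L) {u v w : L} (h1 : ⁅u, v⁆ = w)
    (h2 : ⁅v, w⁆ = u) (h3 : ⁅w, u⁆ = v) (hw : w ≠ 0)
    (hK : Submodule.span ℝ {u, v, w} ≤ K.toSubmodule)
    (hI : ∀ x ∈ K, ∀ y ∈ Submodule.span ℝ {u, v, w}, ⁅x, y⁆ ∈ Submodule.span ℝ {u, v, w}) :
    ∃ I : LieIdeal ℝ K,
      Submodule.map K.toSubmodule.subtype I.toSubmodule = Submodule.span ℝ {u, v, w} ∧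
        Nonempty (I ≃ₗ⁅ℝ⁆ su 2) := by
  let I : LieIdeal ℝ K :=
    { Submodule.comap K.toSubmodule.subtype (Submodule.span ℝ {u, v, w}) with
      lie_mem := fun {x m} hm => hI x x.2 _ hm }
  have memI : ∀ x : K, x ∈ I ↔ (x : L) ∈ Submodule.span ℝ {u, v, w} := fun _ => Iff.rfl
  refine ⟨I, ?_, ?_⟩
  · ext x
    constructor
    · rintro ⟨y, hy, rfl⟩; exact hy
    · intro hx; exact ⟨⟨x, hK hx⟩, hx, rfl⟩
  have hmem : ∀ i, ![u, v, w] i ∈ Submodule.span ℝ {u, v, w} := fun i =>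
    Submodule.subset_span (by fin_cases i <;> simp)
  let t : Fin 3 → I := fun i => ⟨⟨![u, v, w] i, hK (hmem i)⟩, hmem i⟩
  have e1 : ⁅t 0, t 1⁆ = t 2 := Subtype.ext (Subtype.ext h1)
  have e2 : ⁅t 1, t 2⁆ = t 0 := Subtype.ext (Subtype.ext h2)
  have e3 : ⁅t 2, t 0⁆ = t 1 := Subtype.ext (Subtype.ext h3)
  have hw' : t 2 ≠ 0 := fun h => hw (congrArg (fun x : I => ((x : K) : L)) h)
  have ht : t = ![t 0, t 1, t 2] := by ext i : 1; fin_cases i <;> rfl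
  have li : LinearIndependent ℝ t := by
    rw [ht]; exact linearIndependent_of_su2_triple e1 e2 e3 hw'
  have sp : ⊤ ≤ Submodule.span ℝ (Set.range t) := by
    rintro x -
    obtain ⟨a, b, c, h⟩ := Submodule.mem_span_triple.1 ((memI _).1 x.2)
    have : x = a • t 0 + b • t 1 + c • t 2 := Subtype.ext (Subtype.ext h.symm)
    rw [this]
    have hm : ∀ i, t i ∈ Submodule.span ℝ (Set.range t) := fun i =>
      Submodule.subset_span ⟨i, rfl⟩
    exact add_mem (add_mem (Submodule.smul_mem _ _ (hm 0)) (Submodule.smul_mem _ _ (hm 1)))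
      (Submodule.smul_mem _ _ (hm 2))
  obtain ⟨b', f1, f2, f3⟩ := exists_su2_basis
  refine nonempty_lieEquiv_of_su2_bases (Module.Basis.mk li sp) b' ?_ ?_ ?_ f1 f2 f3 <;>
    simpa only [Module.Basis.mk_apply]

end Su2

end IsingChain

namespace IsingChain

open Matrix

/-! ### Invariant forms on a component. -/

namespace OnsagerSeed

variable {L : Type*} [LieRing L] [LieAlgebra ℝ L] {A A' G : ℤ → L} (h : OnsagerSeed A A' G)
variable {b : ℕ → ℝ} {lam : ℝ} (hb : ChebSeq b lam) {n : ℕ} (hn : 0 < n) (hbn : b n = 0)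
  (hG : G n = 0)
  (B : L →ₗ[ℝ] L →ₗ[ℝ] ℝ) (hB : ∀ x y z : L, B ⁅x, y⁆ z = -B y ⁅x, z⁆)

include h hB

lemma form_psi_zero_psi_zero :
    B (psi A b n 0) (psi A b n 0) = B (zeta G b n) (zeta G b n) := by
  have e := hB (A 0) (zeta G b n) (psi A b n 0)
  rw [h.lie_zero_zeta, h.lie_zero_psi_zero, map_smul, map_smul, LinearMap.smul_apply, smul_eq_mul,
    smul_eq_mul] at e
  linarith

lemma form_psi_one_psi_one :
    B (psi A b n 1) (psi A b n 1) = B (zeta G b n) (zeta G b n) := by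
  have e := hB (A 1) (zeta G b n) (psi A b n 1)
  rw [h.lie_one_zeta, h.lie_one_psi_one, map_smul, map_smul, LinearMap.smul_apply, smul_eq_mul,
    smul_eq_mul] at e
  linarith

include hb hn hbn hG

lemma form_psi_zero_psi_one :
    B (psi A b n 0) (psi A b n 1) = -(lam / 2) * B (zeta G b n) (zeta G b n) := by
  have e := hB (A 0) (zeta G b n) (psi A b n 1)
  rw [h.lie_zero_zeta, h.lie_zero_psi_one hb hn hbn hG, map_smul, map_smul, LinearMap.smul_apply,
    smul_eq_mul, smul_eq_mul] at e
  linarith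

lemma form_psi_one_psi_zero :
    B (psi A b n 1) (psi A b n 0) = -(lam / 2) * B (zeta G b n) (zeta G b n) := by
  have e := hB (A 1) (zeta G b n) (psi A b n 0)
  rw [h.lie_one_zeta, h.lie_one_psi_zero hb hn hbn hG, map_smul, map_smul, LinearMap.smul_apply,
    smul_eq_mul, smul_eq_mul] at e
  linarith

/-- Applying `A 0` and then `A 1` to `G m` gives `-8 (G (m+1) + G (m-1))`. By invariance `m ↦ B (G
m) zeta` obeys the recursion of `b`, so it is `b m` times its value at 1, and summing gives `∑ b m ^
2`. -/
lemma form_zeta_zeta : B (zeta G b n) (zeta G b n) =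
    (∑ m ∈ Finset.range n, b m ^ 2) * (-2 * B (A 0) (psi A b n 1)) := by
  set z := zeta G b n
  have hrec : ∀ m : ℤ, B (G (m + 1)) z + B (G (m - 1)) z = -lam * B (G m) z := by
    intro m
    have e1 : ⁅A 1, ⁅A 0, G m⁆⁆ = (-8 : ℝ) • (G (m + 1) + G (m - 1)) := by
      rw [h.lie_zero_G, h.A'_eq, lie_smul, lie_sub, h.lie_one_A, h.lie_one_A,
        show -m - 1 = -(m + 1) by ring, h.G_neg]
      module
    have e2 := hB (A 1) ⁅A 0, G m⁆ z
    rw [e1, hB, h.lie_one_zeta, lie_smul, h.lie_zero_psi_one hb hn hbn hG, map_smul, map_smul,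
      map_smul, map_add, LinearMap.smul_apply, LinearMap.add_apply, smul_eq_mul, smul_eq_mul,
      smul_eq_mul] at e2
    linarith
  have hf := hb.eq_smul (fun m : ℕ => B (G m) z) (by simp [h.G_zero]) (fun m => by
    have := hrec (m + 1)
    rw [add_sub_cancel_right, add_assoc, one_add_one_eq_two] at this
    push_cast
    rw [smul_eq_mul]
    linarith)
  have h1 : B (G 1) z = -2 * B (A 0) (psi A b n 1) := by
    have e := hB (A 1) (A 0) z
    rw [h.lie_one_zeta, map_smul, smul_eq_mul] at e
    rw [h.G_one, map_smul, LinearMap.smul_apply, smul_eq_mul, e]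
    ring
  rw [← h1]
  change B (zeta G b n) z = _
  rw [zeta, map_sum, LinearMap.sum_apply, Finset.sum_mul]
  refine Finset.sum_congr rfl fun m _ => ?_
  have := hf m
  simp only [Nat.cast_one, smul_eq_mul] at this
  rw [map_smul, LinearMap.smul_apply, smul_eq_mul, this]
  ring

end OnsagerSeed

/-! ### The polynomials `a_k` and their values at `±2`. -/

section Sequence

/-- The values `a_k` with alternating signs, shifted so as to start with `a_{-1} = 0`. -/
noncomputable def altSeq (lam : ℝ) : ℕ → ℝ
  | 0 => 0
  | k + 1 => (-1) ^ k * a k lam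

lemma a_add_two (k : ℕ) (lam : ℝ) : a (k + 2) lam = lam * a (k + 1) lam - a k lam := by
  simp [a, aPoly]

lemma altSeq_chebSeq (lam : ℝ) : ChebSeq (altSeq lam) lam where
  zero := rfl
  one := by simp [altSeq, a, aPoly]
  add_two m := by
    rcases m with _ | m
    · simp [altSeq, a, aPoly]
    · simp only [altSeq, a_add_two]; ring

lemma a_two (k : ℕ) : a k 2 = k + 1 := by
  induction k using Nat.twoStepInduction with
  | zero => simp [a, aPoly]
  | one => simp [a, aPoly]; norm_num
  | more k h1 h2 => rw [a_add_two, h1, h2]; push_cast; ring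

lemma a_neg_two (k : ℕ) : a k (-2) = (-1) ^ k * (k + 1) := by
  induction k using Nat.twoStepInduction with
  | zero => simp [a, aPoly]
  | one => simp [a, aPoly]; norm_num
  | more k h1 h2 => rw [a_add_two, h1, h2]; push_cast; ring

lemma ne_two_of_a_eq_zero {k : ℕ} {lam : ℝ} (h : a k lam = 0) : lam ≠ 2 ∧ lam ≠ -2 := by
  have hk : (k : ℝ) + 1 ≠ 0 := by positivity
  constructor
  · rintro rfl; exact hk (a_two k ▸ h)
  · rintro rfl
    rw [a_neg_two] at h
    exact (mul_ne_zero (pow_ne_zero _ (by norm_num)) hk) h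

end Sequence

/-! ### `X̂`, `Ŷ`, `Ẑ` as components, and the trace form. -/

section Chain

variable (n : ℕ) [NeZero n] (lam : ℝ)

lemma Zhat_eq (hn : 3 ≤ n) : Zhat n lam = OnsagerSeed.zeta (genG n) (altSeq lam) n := by
  obtain ⟨p, hp⟩ : ∃ p, n = p + 1 := ⟨n - 1, by omega⟩
  have : Finset.range n = Finset.range (p + 1) := by rw [hp]
  rw [Zhat, OnsagerSeed.zeta, this, Finset.sum_range_succ', altSeq, zero_smul, add_zero,
    show n - 1 = p by omega]
  refine Finset.sum_congr rfl fun k hk => ?_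
  have := Finset.mem_range.1 hk
  rw [bYZ_eq (by omega), altSeq]
  push_cast
  module

lemma Yhat_eq (hn : 3 ≤ n) : Yhat n lam = -OnsagerSeed.psi (genA n) (altSeq lam) n 0 := by
  obtain ⟨p, hp⟩ : ∃ p, n = p + 1 := ⟨n - 1, by omega⟩
  have : Finset.range n = Finset.range (p + 1) := by rw [hp]
  rw [Yhat, OnsagerSeed.psi, this, Finset.sum_range_succ', altSeq, zero_smul, add_zero,
    show n - 1 = p by omega, ← Finset.sum_neg_distrib]
  refine Finset.sum_congr rfl fun k hk => ?_
  have := Finset.mem_range.1 hk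
  rw [bY_eq (by omega), bZ_eq (by omega), altSeq, zero_add, zero_sub]
  push_cast
  module

lemma Xhat_eq (hn : 3 ≤ n) : Xhat n lam = -OnsagerSeed.psi (genA n) (altSeq lam) n 1 := by
  obtain ⟨p, hp⟩ : ∃ p, n = p + 3 := ⟨n - 3, by omega⟩
  have : Finset.range n = Finset.range (p + 1 + 1 + 1) := by rw [hp]
  have e1 := bXX_eq (n := n) (by omega)
  have e2 := bY_eq (n := n) (k := n - 3) (by omega)
  rw [show n - 1 = p + 2 by omega, show ((n : ℕ) : ℤ) = p + 3 by omega] at e1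
  rw [show n - 3 = p by omega] at e2
  -- The term `m = 0` vanishes, `m = 1` gives `𝐗 + 𝐙^1`, and `m = n - 1` gives `𝐗𝐗 - 𝐘^{n-3}`. The
  -- middle terms match the sum over `k` with `m = k + 1`.
  rw [Xhat, OnsagerSeed.psi, this, Finset.sum_range_succ', altSeq, zero_smul, add_zero,
    Finset.sum_range_succ, Finset.sum_range_succ', bX_eq, bZ_eq (by omega), e1,
    show n - 2 = p + 1 by omega, show n - 3 = p by omega, e2,
    Finset.range_eq_Ico, Finset.sum_Ico_add' (fun k : ℕ => altSeq lam (k + 1) •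
      (genA n (1 + ((k + 1 : ℕ) : ℤ)) - genA n (1 - ((k + 1 : ℕ) : ℤ)))) 0 p 1, zero_add]
  have e3 : ∑ k ∈ Finset.Icc 1 p, a k lam • (bZ n (k + 1) - bY n (k - 1)) =
      -∑ k ∈ Finset.Ico 1 (p + 1), altSeq lam (k + 1) •
        (genA n (1 + ((k + 1 : ℕ) : ℤ)) - genA n (1 - ((k + 1 : ℕ) : ℤ))) := by
    rw [← Finset.sum_neg_distrib]
    refine Finset.sum_congr rfl fun k hk => ?_
    obtain ⟨h1, h2⟩ := Finset.mem_Icc.1 hk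
    obtain ⟨j, rfl⟩ : ∃ j, k = j + 1 := ⟨k - 1, by omega⟩
    rw [bZ_eq (by omega), bY_eq (by omega), altSeq, add_tsub_cancel_right]
    push_cast
    rw [show (1 : ℤ) + (j + 1 + 1) = j + 1 + 1 + 1 by ring,
      show (1 : ℤ) - (j + 1 + 1) = -(j + 1) by ring]
    module
  rw [e3, altSeq, altSeq]
  push_cast
  rw [show (1 : ℤ) + (p + 1 + 1) = p + 3 by ring, show (1 : ℤ) - (p + 1 + 1) = -(p + 1) by ring]
  module

/-- The invariant form `-Tr(A B) / (n 2ⁿ)`. -/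
noncomputable def traceForm : ChainMat n →ₗ[ℝ] ChainMat n →ₗ[ℝ] ℝ :=
  LinearMap.mk₂ ℝ (fun A B => -(1 / ((n : ℝ) * 2 ^ n)) * (trace (A * B)).re)
    (fun A A' B => by rw [add_mul, trace_add, Complex.add_re]; ring)
    (fun c A B => by
      rw [smul_mul_assoc, trace_smul, Complex.real_smul, Complex.re_ofReal_mul, smul_eq_mul]; ring)
    (fun A B B' => by rw [mul_add, trace_add, Complex.add_re]; ring)
    (fun c A B => by
      rw [mul_smul_comm, trace_smul, Complex.real_smul, Complex.re_ofReal_mul, smul_eq_mul]; ring)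

omit [NeZero n] in
lemma traceForm_apply (A B : ChainMat n) :
    traceForm n A B = -(1 / ((n : ℝ) * 2 ^ n)) * (trace (A * B)).re := rfl

omit [NeZero n] in
lemma traceForm_invariant (x y z : ChainMat n) : traceForm n ⁅x, y⁆ z = -traceForm n y ⁅x, z⁆ := by
  have : trace (⁅x, y⁆ * z) = -trace (y * ⁅x, z⁆) := by
    rw [Ring.lie_def, Ring.lie_def, sub_mul, mul_sub, trace_sub, trace_sub, mul_assoc,
      trace_mul_comm x (y * z), mul_assoc, mul_assoc, neg_sub]
  rw [traceForm_apply, traceForm_apply, this, Complex.neg_re]; ring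

omit [NeZero n] in
lemma traceNorm_sq {A : ChainMat n} (hA : Aᴴ = -A) : traceNorm A = √(traceForm n A A) := by
  rw [traceNorm, traceForm_apply, hA, mul_neg, trace_neg, Complex.neg_re]
  congr 1; ring

omit [NeZero n] in
-- The trace of a tensor product vanishes with the trace of a single factor; `hM` supplies such a
-- factor wherever `σ_x` is inserted.
lemma trace_H1_mul_symmetrize {M : Fin n → Matrix (Fin 2) (Fin 2) ℂ}
    (hM : ∀ j, ∃ i, trace (if i = j then sigmaX * M i else M i) = 0) :
    trace (H1 n * symmetrize (tensor M)) = 0 := by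
  rw [symmetrize_eq, H1, Finset.sum_mul, trace_sum]
  refine Finset.sum_eq_zero fun j _ => ?_
  rw [Finset.mul_sum, trace_sum]
  refine Finset.sum_eq_zero fun k _ => ?_
  rw [shiftConj_tensor, site, tensor_mul, trace_tensor]
  obtain ⟨i, hi⟩ := hM ((finRotate n ^ k) j)
  refine Finset.prod_eq_zero (Finset.mem_univ ((finRotate n ^ k).symm i)) ?_
  rw [← hi, Equiv.apply_symm_apply]
  by_cases h : i = (finRotate n ^ k) j
  · rw [if_pos h, if_pos ((Equiv.symm_apply_eq _).2 h)]
  · rw [if_neg h, if_neg fun h' => h ((Equiv.symm_apply_eq _).1 h'), one_mul]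

lemma trace_H1_mul_block {A B : Matrix (Fin 2) (Fin 2) ℂ} (hA : trace A = 0)
    (hA' : trace (sigmaX * A) = 0) (k : ℕ) :
    trace (H1 n * symmetrize (block n A B k)) = 0 := by
  refine trace_H1_mul_symmetrize n fun j => ⟨⟨0, NeZero.pos n⟩, ?_⟩
  split_ifs <;> simp_all

omit [NeZero n] in
lemma trace_H1_mul_XX (hn : 3 ≤ n) : trace (H1 n * symmetrize
    (tensor fun i : Fin n => if i.val + 1 < n then sigmaX else 1)) = 0 := by
  have htr : trace sigmaX = 0 := by simp [sigmaX, trace, Fin.sum_univ_two]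
  refine trace_H1_mul_symmetrize n fun j => ?_
  -- For `n ≥ 3` both sites 0 and 1 carry `σ_x`, and at least one of them differs from `j` and stays
  -- traceless.
  by_cases hj : j.val = 0
  · refine ⟨⟨1, by omega⟩, ?_⟩
    rw [if_neg (by rw [Fin.ext_iff]; simp; omega), if_pos (by simp; omega), htr]
  · refine ⟨⟨0, by omega⟩, ?_⟩
    rw [if_neg (by rw [Fin.ext_iff]; simp; omega), if_pos (by simp; omega), htr]

omit [NeZero n] in
lemma trace_H1_mul_H1 : trace (H1 n * H1 n) = n * 2 ^ n := by
  have htr : trace sigmaX = 0 := by simp [sigmaX, trace, Fin.sum_univ_two]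
  have h1 : ∀ i j : Fin n, trace (site sigmaX i * site sigmaX j) = if i = j then 2 ^ n else 0 := by
    intro i j
    split_ifs with h
    · subst h
      rw [site_mul_same, sigmaX_sq, site_one, trace_one]
      simp
    · rw [site, site, tensor_mul, trace_tensor]
      exact Finset.prod_eq_zero (Finset.mem_univ i) (by simp [h, htr])
  rw [H1, Finset.sum_mul, trace_sum]
  simp only [Finset.mul_sum, trace_sum, h1]
  simp

lemma traceForm_bX_I_smul (A : ChainMat n) : traceForm n (bX n) (Complex.I • A) =
    1 / ((n : ℝ) * 2 ^ n) * (trace (H1 n * A)).re := by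
  rw [bX_eq, genA_zero, traceForm_apply, smul_mul_smul_comm, Complex.I_mul_I, neg_one_smul,
    trace_neg, Complex.neg_re]
  ring

/-- `𝐗` is orthogonal to every other generator in `X̂`, and its coefficient there is `a_0 = 1`. This
is the only trace that fixes the scale of the form. -/
lemma traceForm_bX_Xhat (hn : 3 ≤ n) : traceForm n (bX n) (Xhat n lam) = 1 := by
  have hZ : ∀ k, traceForm n (bX n) (bZ n k) = 0 := fun k => by
    rw [bZ, traceForm_bX_I_smul, trace_H1_mul_block, Complex.zero_re, mul_zero] <;>
      simp [sigmaX, sigmaZ, trace, Fin.sum_univ_two]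
  have hY : ∀ k, traceForm n (bX n) (bY n k) = 0 := fun k => by
    rw [bY, traceForm_bX_I_smul, trace_H1_mul_block, Complex.zero_re, mul_zero] <;>
      simp [sigmaX, sigmaY, trace, Fin.sum_univ_two]
  have hXX : traceForm n (bX n) (bXX n) = 0 := by
    rw [bXX, traceForm_bX_I_smul, trace_H1_mul_XX n hn, Complex.zero_re, mul_zero]
  have hX : traceForm n (bX n) (bX n) = 1 := by
    nth_rw 2 [bX_eq]
    rw [genA_zero, traceForm_bX_I_smul, trace_H1_mul_H1]
    have : ((n : ℂ) * 2 ^ n).re = (n : ℝ) * 2 ^ n := by norm_cast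
    rw [this]
    have := NeZero.ne n
    field_simp
  rw [Xhat]
  simp only [map_add, map_smul, map_sub, map_sum, hZ, hY, hX, hXX]
  simp [a, aPoly]

end Chain

end IsingChain

namespace IsingChain

open Matrix OnsagerSeed

/-! ### Membership in the dynamical Lie algebra and stability under it. -/

section Main

variable (n : ℕ)

lemma conjTranspose_H1 : (H1 n)ᴴ = H1 n := by
  rw [H1, conjTranspose_sum]
  exact Finset.sum_congr rfl fun i _ => conjTranspose_site conjTranspose_sigmaX i

lemma conjTranspose_H0 : (H0 n)ᴴ = H0 n := by
  rw [H0, conjTranspose_sum]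
  refine Finset.sum_congr rfl fun i _ => ?_
  rw [conjTranspose_mul, conjTranspose_site conjTranspose_sigmaZ,
    conjTranspose_site conjTranspose_sigmaZ, site_mul_comm]

/-- On skew-Hermitian matrices `Tr(A A†) = -Tr(A A)`, so there the norm comes from the invariant
form. -/
lemma conjTranspose_of_mem_dynamicalLieAlgebra {x : ChainMat n} (hx : x ∈ dynamicalLieAlgebra n) :
    xᴴ = -x := by
  induction hx using LieSubalgebra.lieSpan_induction with
  | mem x hx =>
    rcases hx with rfl | rfl
    · rw [conjTranspose_smul, conjTranspose_H0]; simp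
    · rw [conjTranspose_smul, conjTranspose_H1]; simp
  | zero => simp
  | add x y _ _ hx hy => rw [conjTranspose_add, hx, hy, neg_add]
  | smul c x _ hx => rw [conjTranspose_smul, hx, star_trivial, smul_neg]
  | lie x y _ _ hx hy =>
    rw [Ring.lie_def, conjTranspose_sub, conjTranspose_mul, conjTranspose_mul, hx, hy, neg_mul_neg,
      neg_mul_neg, neg_sub]

open scoped ComplexOrder in
lemma traceForm_nonneg {A : ChainMat n} (hA : Aᴴ = -A) : 0 ≤ traceForm n A A := by
  have h := (Matrix.posSemidef_self_mul_conjTranspose A).trace_nonneg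
  rw [hA, mul_neg, trace_neg, Complex.nonneg_iff, Complex.neg_re] at h
  rw [traceForm_apply, neg_mul, ← mul_neg]
  exact mul_nonneg (by positivity) h.1

variable [NeZero n]

lemma genA_zero_mem : genA n 0 ∈ dynamicalLieAlgebra n := by
  rw [genA_zero]; exact LieSubalgebra.subset_lieSpan (by simp)

lemma genA_one_mem : genA n 1 ∈ dynamicalLieAlgebra n := by
  rw [genA_one]; exact LieSubalgebra.subset_lieSpan (by simp)

lemma psi_mem (b : ℕ → ℝ) (l : ℤ) : psi (genA n) b n l ∈ dynamicalLieAlgebra n := by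
  have hA := genA_seed.A_mem (dynamicalLieAlgebra n) (genA_zero_mem n) (genA_one_mem n)
  exact sum_mem fun m _ => SMulMemClass.smul_mem _ (sub_mem (hA _) (hA _))

lemma zeta_mem (b : ℕ → ℝ) : zeta (genG n) b n ∈ dynamicalLieAlgebra n := by
  have hG := genA_seed.G_mem (dynamicalLieAlgebra n) (genA_zero_mem n) (genA_one_mem n)
  exact sum_mem fun m _ => SMulMemClass.smul_mem _ (hG _)

omit [NeZero n] in
-- The elements that stabilize a subspace form a Lie subalgebra by Jacobi, so the two generators
-- suffice.
lemma lie_mem_of_mem_dynamicalLieAlgebra {s : Set (ChainMat n)}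
    (h0 : ∀ v ∈ s, ⁅Complex.I • H0 n, v⁆ ∈ Submodule.span ℝ s)
    (h1 : ∀ v ∈ s, ⁅Complex.I • H1 n, v⁆ ∈ Submodule.span ℝ s) {x : ChainMat n}
    (hx : x ∈ dynamicalLieAlgebra n) : ∀ y ∈ Submodule.span ℝ s, ⁅x, y⁆ ∈ Submodule.span ℝ s := by
  have ext : ∀ x : ChainMat n, (∀ v ∈ s, ⁅x, v⁆ ∈ Submodule.span ℝ s) →
      ∀ y ∈ Submodule.span ℝ s, ⁅x, y⁆ ∈ Submodule.span ℝ s := by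
    intro x hx y hy
    induction hy using Submodule.span_induction with
    | mem v hv => exact hx v hv
    | zero => rw [lie_zero]; exact zero_mem _
    | add v w _ _ hv hw => rw [lie_add]; exact add_mem hv hw
    | smul c v _ hv => rw [lie_smul]; exact Submodule.smul_mem _ _ hv
  induction hx using LieSubalgebra.lieSpan_induction with
  | mem x hx =>
    rcases hx with rfl | rfl
    · exact ext _ h0
    · exact ext _ h1
  | zero => intro y _; rw [zero_lie]; exact zero_mem _
  | add x y _ _ hx hy => intro v hv; rw [add_lie]; exact add_mem (hx v hv) (hy v hv)
  | smul c x _ hx => intro v hv; rw [smul_lie]; exact Submodule.smul_mem _ _ (hx v hv)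
  | lie x y _ _ hx hy =>
    intro v hv
    rw [lie_lie]
    exact sub_mem (hx _ (hy v hv)) (hy _ (hx v hv))

end Main

/-! ### The normalized triple at a root. -/

section Triple

variable (n : ℕ) [NeZero n] (lam : ℝ)

/-- The squared norm of the sequence `a_0, …, a_{n-2}`. -/
noncomputable def coeffNormSq : ℝ := ∑ m ∈ Finset.range n, altSeq lam m ^ 2

variable {n lam} (hn : 3 ≤ n) (hlam : altSeq lam n = 0)

include hn

omit [NeZero n] in
lemma coeffNormSq_pos : 0 < coeffNormSq n lam :=
  Finset.sum_pos' (fun _ _ => sq_nonneg _)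
    ⟨1, Finset.mem_range.2 (by omega), by simp [(altSeq_chebSeq lam).one]⟩

lemma Xhat_mem : Xhat n lam ∈ dynamicalLieAlgebra n := by
  rw [Xhat_eq n lam hn]; exact neg_mem (psi_mem n _ _)

lemma Yhat_mem : Yhat n lam ∈ dynamicalLieAlgebra n := by
  rw [Yhat_eq n lam hn]; exact neg_mem (psi_mem n _ _)

lemma Zhat_mem : Zhat n lam ∈ dynamicalLieAlgebra n := by
  rw [Zhat_eq n lam hn]; exact zeta_mem n _

lemma idealSpan_le : idealSpan n lam ≤ (dynamicalLieAlgebra n).toSubmodule := by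
  rw [idealSpan, Submodule.span_le]
  rintro x (rfl | rfl | rfl)
  exacts [Xhat_mem hn, Yhat_mem hn, Zhat_mem hn]

include hlam

lemma lie_Xhat_Yhat :
    ⁅Xhat n lam, Yhat n lam⁆ = (2 * (4 - lam ^ 2) * coeffNormSq n lam) • Zhat n lam := by
  rw [Xhat_eq n lam hn, Yhat_eq n lam hn, Zhat_eq n lam hn, neg_lie, lie_neg, neg_neg,
    genA_seed.lie_psi_one_psi_zero (altSeq_chebSeq lam) (by omega) hlam (genG_card (by omega)),
    coeffNormSq]

lemma lie_Zhat_Yhat : ⁅Zhat n lam, Yhat n lam⁆ =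
    (-4 * coeffNormSq n lam) • ((2 : ℝ) • Xhat n lam + lam • Yhat n lam) := by
  rw [Xhat_eq n lam hn, Yhat_eq n lam hn, Zhat_eq n lam hn, lie_neg,
    genA_seed.lie_zeta_psi_zero (altSeq_chebSeq lam) (by omega) hlam (genG_card (by omega)),
    coeffNormSq]
  module

lemma lie_Zhat_Xhat : ⁅Zhat n lam, Xhat n lam⁆ =
    (4 * coeffNormSq n lam) • (lam • Xhat n lam + (2 : ℝ) • Yhat n lam) := by
  rw [Xhat_eq n lam hn, Yhat_eq n lam hn, Zhat_eq n lam hn, lie_neg,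
    genA_seed.lie_zeta_psi_one (altSeq_chebSeq lam) (by omega) hlam (genG_card (by omega)),
    coeffNormSq]
  module

lemma lie_mem_idealSpan {x : ChainMat n} (hx : x ∈ dynamicalLieAlgebra n) :
    ∀ y ∈ idealSpan n lam, ⁅x, y⁆ ∈ idealSpan n lam := by
  have hX : Xhat n lam ∈ idealSpan n lam := Submodule.subset_span (by simp)
  have hY : Yhat n lam ∈ idealSpan n lam := Submodule.subset_span (by simp)
  have hZ : Zhat n lam ∈ idealSpan n lam := Submodule.subset_span (by simp)
  have eX := Xhat_eq n lam hn
  have eY := Yhat_eq n lam hn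
  have eZ := Zhat_eq n lam hn
  have hb := altSeq_chebSeq lam
  have hG := genG_card (n := n) (by omega)
  refine lie_mem_of_mem_dynamicalLieAlgebra n ?_ ?_ hx
  · rw [← genA_one]
    rintro v (rfl | rfl | rfl)
    · change _ ∈ idealSpan n lam
      rw [eX, lie_neg, genA_seed.lie_one_psi_one, ← eZ]
      exact neg_mem (Submodule.smul_mem _ _ hZ)
    · change _ ∈ idealSpan n lam
      rw [eY, lie_neg, genA_seed.lie_one_psi_zero hb (by omega) hlam hG, ← eZ]
      exact neg_mem (Submodule.smul_mem _ _ hZ)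
    · change _ ∈ idealSpan n lam
      rw [eZ, genA_seed.lie_one_zeta, ← neg_neg (psi _ _ _ _), ← eX]
      exact Submodule.smul_mem _ _ (neg_mem hX)
  · rw [← genA_zero]
    rintro v (rfl | rfl | rfl)
    · change _ ∈ idealSpan n lam
      rw [eX, lie_neg, genA_seed.lie_zero_psi_one hb (by omega) hlam hG, ← eZ]
      exact neg_mem (Submodule.smul_mem _ _ hZ)
    · change _ ∈ idealSpan n lam
      rw [eY, lie_neg, genA_seed.lie_zero_psi_zero, ← eZ]
      exact neg_mem (Submodule.smul_mem _ _ hZ)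
    · change _ ∈ idealSpan n lam
      rw [eZ, genA_seed.lie_zero_zeta, ← neg_neg (psi _ _ _ _), ← eY]
      exact Submodule.smul_mem _ _ (neg_mem hY)

lemma traceForm_Zhat : traceForm n (Zhat n lam) (Zhat n lam) = 2 * coeffNormSq n lam := by
  have h := genA_seed.form_zeta_zeta (altSeq_chebSeq lam) (by omega) hlam (genG_card (by omega))
    (traceForm n) (traceForm_invariant n)
  have e := traceForm_bX_Xhat n lam hn
  rw [Xhat_eq n lam hn, map_neg, bX_eq] at e
  rw [Zhat_eq n lam hn, h, ← coeffNormSq]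
  linear_combination (2 * coeffNormSq n lam) * e

lemma traceForm_tildeSx : traceForm n (tildeSx n lam) (tildeSx n lam) =
    (2 - lam) * (2 * coeffNormSq n lam) := by
  rw [tildeSx, ← traceForm_Zhat hn hlam, Xhat_eq n lam hn, Yhat_eq n lam hn, Zhat_eq n lam hn]
  have hb := altSeq_chebSeq lam
  have hG := genG_card (n := n) (by omega)
  have hB := traceForm_invariant n
  simp only [map_add, map_neg, LinearMap.add_apply, LinearMap.neg_apply,
    genA_seed.form_psi_zero_psi_zero _ hB, genA_seed.form_psi_one_psi_one _ hB,
    genA_seed.form_psi_zero_psi_one hb (by omega) hlam hG _ hB,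
    genA_seed.form_psi_one_psi_zero hb (by omega) hlam hG _ hB]
  ring

lemma traceForm_tildeSy : traceForm n (tildeSy n lam) (tildeSy n lam) =
    (2 + lam) * (2 * coeffNormSq n lam) := by
  rw [tildeSy, ← traceForm_Zhat hn hlam, Xhat_eq n lam hn, Yhat_eq n lam hn, Zhat_eq n lam hn]
  have hb := altSeq_chebSeq lam
  have hG := genG_card (n := n) (by omega)
  have hB := traceForm_invariant n
  simp only [map_sub, map_neg, LinearMap.sub_apply, LinearMap.neg_apply,
    genA_seed.form_psi_zero_psi_zero _ hB, genA_seed.form_psi_one_psi_one _ hB,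
    genA_seed.form_psi_zero_psi_one hb (by omega) hlam hG _ hB,
    genA_seed.form_psi_one_psi_zero hb (by omega) hlam hG _ hB]
  ring

omit hlam in
lemma tildeSx_skew : (tildeSx n lam)ᴴ = -tildeSx n lam :=
  conjTranspose_of_mem_dynamicalLieAlgebra n (add_mem (Xhat_mem hn) (Yhat_mem hn))

omit hlam in
lemma tildeSy_skew : (tildeSy n lam)ᴴ = -tildeSy n lam :=
  conjTranspose_of_mem_dynamicalLieAlgebra n (sub_mem (Xhat_mem hn) (Yhat_mem hn))

/-- No formula for the roots is used: both squared norms are nonnegative, giving `|lam| ≤ 2`, and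
`±2` are not roots. -/
lemma lam_bounds : 0 < 2 - lam ∧ 0 < 2 + lam := by
  have hS := coeffNormSq_pos (lam := lam) hn
  have h1 := traceForm_nonneg n (tildeSx_skew (lam := lam) hn)
  have h2 := traceForm_nonneg n (tildeSy_skew (lam := lam) hn)
  rw [traceForm_tildeSx hn hlam] at h1
  rw [traceForm_tildeSy hn hlam] at h2
  have h1' := nonneg_of_mul_nonneg_left h1 (by positivity)
  have h2' := nonneg_of_mul_nonneg_left h2 (by positivity)
  obtain ⟨k, hk⟩ : ∃ k, n = k + 1 := ⟨n - 1, by omega⟩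
  have ha : a k lam = 0 := by
    rw [hk, altSeq] at hlam
    exact (mul_eq_zero.1 hlam).resolve_left (pow_ne_zero _ (by norm_num))
  obtain ⟨e1, e2⟩ := ne_two_of_a_eq_zero ha
  exact ⟨lt_of_le_of_ne h1' fun h => e1 (by linarith),
    lt_of_le_of_ne h2' fun h => e2 (by linarith)⟩

/-- The brackets of the normalized generators. -/
theorem lie_Sx_Sy_Sz : ⁅Sx n lam, Sy n lam⁆ = Sz n lam ∧ ⁅Sy n lam, Sz n lam⁆ = Sx n lam ∧
    ⁅Sz n lam, Sx n lam⁆ = Sy n lam := by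
  have hS := coeffNormSq_pos (lam := lam) hn
  obtain ⟨h1, h2⟩ := lam_bounds hn hlam
  have eN : traceNorm (tildeSx n lam) ^ 2 = (2 - lam) * (2 * coeffNormSq n lam) := by
    rw [traceNorm_sq n (tildeSx_skew hn), traceForm_tildeSx hn hlam, Real.sq_sqrt (by positivity)]
  have eM : traceNorm (tildeSy n lam) ^ 2 = (2 + lam) * (2 * coeffNormSq n lam) := by
    rw [traceNorm_sq n (tildeSy_skew hn), traceForm_tildeSy hn hlam, Real.sq_sqrt (by positivity)]
  have es : Real.sqrt (2 - lam) ^ 2 = 2 - lam := Real.sq_sqrt h1.le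
  have hXY := lie_Xhat_Yhat hn hlam
  have hZY := lie_Zhat_Yhat hn hlam
  have hZX := lie_Zhat_Xhat hn hlam
  have hYX : ⁅Yhat n lam, Xhat n lam⁆ =
      -((2 * (4 - lam ^ 2) * coeffNormSq n lam) • Zhat n lam) := by rw [← lie_skew, hXY]
  have hYZ : ⁅Yhat n lam, Zhat n lam⁆ =
    -((-4 * coeffNormSq n lam) • ((2 : ℝ) • Xhat n lam + lam • Yhat n lam)) := by
    rw [← lie_skew, hZY]
  have hXZ : ⁅Xhat n lam, Zhat n lam⁆ =
    -((4 * coeffNormSq n lam) • (lam • Xhat n lam + (2 : ℝ) • Yhat n lam)) := by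
    rw [← lie_skew, hZX]
  simp only [Sx, Sy, Sz]
  generalize hN' : traceNorm (tildeSx n lam) = N at *
  generalize hM' : traceNorm (tildeSy n lam) = M at *
  generalize hs' : Real.sqrt (2 - lam) = s at *
  generalize hS' : coeffNormSq n lam = S at *
  have hs : s ≠ 0 := fun h => by rw [h] at es; linarith
  have hN : N ≠ 0 := fun h => by
    rw [h] at eN; nlinarith [mul_pos h1 hS]
  have hM : M ≠ 0 := fun h => by
    rw [h] at eM; nlinarith [mul_pos h2 hS]
  rw [tildeSx, tildeSy]
  simp only [smul_lie, lie_smul, add_lie, lie_add, sub_lie, lie_sub, lie_self, hXY, hYX, hZY, hYZ,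
    hZX, hXZ]
  -- Eliminating `lam` removes the square root: `4 - lam²` becomes `s² (4 - s²)`, and each bracket
  -- reduces to one of the norm identities `eM`, `eN`.
  have e2 : lam = 2 - s ^ 2 := by linarith
  subst e2
  refine ⟨?_, ?_, ?_⟩
  · have : (1 / (2 * N * M)) = (2 * (4 - (2 - s ^ 2) ^ 2) * S) * 2 *
        ((1 / (2 * s * N * M)) * (1 / (2 * s * M ^ 2))) := by
      field_simp
      linear_combination s ^ 2 * eM
    rw [this]
    module
  · have : 1 / (2 * s * N * M) = (4 * S * (4 - s ^ 2)) *
        ((1 / (2 * s * M ^ 2)) * (1 / (2 * N * M))) := by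
      field_simp
      linear_combination 2 * eM
    rw [this]
    module
  · have : 1 / (2 * s * M ^ 2) = (4 * S * s ^ 2) *
        ((1 / (2 * N * M)) * (1 / (2 * s * N * M))) := by
      field_simp
      linear_combination 2 * eN
    rw [this]
    module

theorem span_Sx_Sy_Sz :
    Submodule.span ℝ {Sx n lam, Sy n lam, Sz n lam} = idealSpan n lam := by
  have hS := coeffNormSq_pos (lam := lam) hn
  obtain ⟨h1, h2⟩ := lam_bounds hn hlam
  have hN : traceNorm (tildeSx n lam) ≠ 0 := by
    rw [traceNorm_sq n (tildeSx_skew hn), traceForm_tildeSx hn hlam]; positivity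
  have hM : traceNorm (tildeSy n lam) ≠ 0 := by
    rw [traceNorm_sq n (tildeSy_skew hn), traceForm_tildeSy hn hlam]; positivity
  have hs : Real.sqrt (2 - lam) ≠ 0 := by positivity
  have hX : Xhat n lam ∈ idealSpan n lam := Submodule.subset_span (by simp)
  have hY : Yhat n lam ∈ idealSpan n lam := Submodule.subset_span (by simp)
  have hZ : Zhat n lam ∈ idealSpan n lam := Submodule.subset_span (by simp)
  apply le_antisymm
  · rw [Submodule.span_le]
    rintro v (rfl | rfl | rfl)
    · exact Submodule.smul_mem _ _ (add_mem hX hY)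
    · exact Submodule.smul_mem _ _ (sub_mem hX hY)
    · exact Submodule.smul_mem _ _ hZ
  · have hx : tildeSx n lam ∈ Submodule.span ℝ {Sx n lam, Sy n lam, Sz n lam} := by
      rw [← Submodule.smul_mem_iff _ (show -(1 / (2 * Real.sqrt (2 - lam) *
        traceNorm (tildeSx n lam) * traceNorm (tildeSy n lam))) ≠ 0 by
          rw [neg_ne_zero]; exact one_div_ne_zero (by simp [hs, hN, hM]))]
      exact Submodule.subset_span (by simp [Sx])
    have hy : tildeSy n lam ∈ Submodule.span ℝ {Sx n lam, Sy n lam, Sz n lam} := by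
      rw [← Submodule.smul_mem_iff _ (show 1 / (2 * Real.sqrt (2 - lam) *
        traceNorm (tildeSy n lam) ^ 2) ≠ 0 from one_div_ne_zero (by simp [hs, hM]))]
      exact Submodule.subset_span (by simp [Sy])
    have hz : Zhat n lam ∈ Submodule.span ℝ {Sx n lam, Sy n lam, Sz n lam} := by
      rw [← Submodule.smul_mem_iff _ (show 1 / (2 * traceNorm (tildeSx n lam) *
        traceNorm (tildeSy n lam)) ≠ 0 from one_div_ne_zero (by simp [hN, hM]))]
      exact Submodule.subset_span (by simp [Sz])
    rw [idealSpan, Submodule.span_le]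
    rintro v (rfl | rfl | rfl)
    · have : Xhat n lam = (1 / 2 : ℝ) • (tildeSx n lam + tildeSy n lam) := by
        rw [tildeSx, tildeSy]; module
      rw [this]
      exact Submodule.smul_mem _ _ (add_mem hx hy)
    · have : Yhat n lam = (1 / 2 : ℝ) • (tildeSx n lam - tildeSy n lam) := by
        rw [tildeSx, tildeSy]; module
      rw [this]
      exact Submodule.smul_mem _ _ (sub_mem hx hy)
    · exact hz

lemma Sz_ne_zero : Sz n lam ≠ 0 := by
  have hS := coeffNormSq_pos (lam := lam) hn
  obtain ⟨h1, h2⟩ := lam_bounds hn hlam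
  have hN : traceNorm (tildeSx n lam) ≠ 0 := by
    rw [traceNorm_sq n (tildeSx_skew hn), traceForm_tildeSx hn hlam]; positivity
  have hM : traceNorm (tildeSy n lam) ≠ 0 := by
    rw [traceNorm_sq n (tildeSy_skew hn), traceForm_tildeSy hn hlam]; positivity
  refine smul_ne_zero (one_div_ne_zero (by simp [hN, hM])) fun h => ?_
  have := traceForm_Zhat hn hlam
  rw [h, map_zero] at this
  linarith

end Triple

end IsingChain

theorem mainTheorem5 (n : ℕ) (hn : 3 ≤ n) (lam : ℝ)
    (hlam : (IsingChain.aPoly (n - 1)).IsRoot lam) :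
    LinearIndependent ℝ
        ![IsingChain.Sx n lam, IsingChain.Sy n lam, IsingChain.Sz n lam] ∧
      Submodule.span ℝ {IsingChain.Sx n lam, IsingChain.Sy n lam, IsingChain.Sz n lam} =
        IsingChain.idealSpan n lam ∧
      ⁅IsingChain.Sx n lam, IsingChain.Sy n lam⁆ = IsingChain.Sz n lam ∧
      ⁅IsingChain.Sy n lam, IsingChain.Sz n lam⁆ = IsingChain.Sx n lam ∧
      ⁅IsingChain.Sz n lam, IsingChain.Sx n lam⁆ = IsingChain.Sy n lam ∧
      ∃ I : LieIdeal ℝ (IsingChain.dynamicalLieAlgebra n),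
        Submodule.map (IsingChain.dynamicalLieAlgebra n).toSubmodule.subtype I.toSubmodule =
            IsingChain.idealSpan n lam ∧
          Nonempty (I ≃ₗ⁅ℝ⁆ IsingChain.su 2) := by
  have : NeZero n := ⟨by omega⟩
  -- `altSeq` is shifted by one, so a root of `a_{n-1}` makes its entry at `n` vanish.
  have hb : IsingChain.altSeq lam n = 0 := by
    obtain ⟨k, rfl⟩ : ∃ k, n = k + 1 := ⟨n - 1, by omega⟩
    have h : IsingChain.a k lam = 0 := hlam
    rw [IsingChain.altSeq, h, mul_zero]
  obtain ⟨h1, h2, h3⟩ := IsingChain.lie_Sx_Sy_Sz hn hb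
  have hz := IsingChain.Sz_ne_zero hn hb
  have hspan := IsingChain.span_Sx_Sy_Sz hn hb
  refine ⟨IsingChain.linearIndependent_of_su2_triple h1 h2 h3 hz, hspan, h1, h2, h3, ?_⟩
  rw [← hspan]
  refine IsingChain.exists_lieIdeal_su2 _ h1 h2 h3 hz ?_ ?_ <;> rw [hspan]
  · exact IsingChain.idealSpan_le hn
  · exact fun x hx => IsingChain.lie_mem_idealSpan hn hb hx
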